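/- Let $\gamma\in\mathbb H=\{z\in\mathbb C:\operatorname{Im}z>0\}$, let $n\ge 2$, and let $X_1,\dots,X_n$ be i.i.d. real random variables with the Cauchy distribution with parameter $\gamma$, i.e. with density $x\mapsto \frac{\sigma}{\pi}\,\frac{1}{(x-\mu)^2+\sigma^2}$ where $\gamma=\mu+i\sigma$. Let $\alpha\in\overline{\mathbb H}=\{z\in\mathbb C:\operatorname{Im}z\ge 0\}$. Powers of complex numbers are taken with the principal branch of the logarithm, $\arg z\in(-\pi,\pi]$, and $0^q=0$ for $q>0$. For $0<p\le 1$ let $f_p(z)=f^{(\alpha)}_p(z)=(z+\alpha)^p$, which is injective on $\overline{\mathbb H}$ with convex image, and let $$M^{f_p}_n=f_p^{-1}\Big(\frac1n\sum_{j=1}^n f_p(X_j)\Big)$$ be the corresponding quasi-arithmetic mean, where $f_p^{-1}:f_p(\overline{\mathbb H})\to\overline{\mathbb H}$. Let $$G^{(\alpha)}_n=\prod_{j=1}^n (X_j+\alpha)^{1/n}-\alpha .$$ (i) (Unbiasedness) For every $0<p<1$, the random variable $n^{1/p}M^{f_p}_n-nM^{f_1}_n$ is integrable, and $$E\left[\frac{n^{1/p}M^{f_p}_n-nM^{f_1}_n}{n^{1/p}-n}\right]=\gamma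 .$$ (ii) (Parameter limit) $$\lim_{p\to 0+}\frac{n^{1/p}M^{f_p}_n-nM^{f_1}_n}{n^{1/p}-n}=G^{(\alpha)}_n\qquad\text{almost surely and in }L^1 .$$ -/

import Mathlib

open MeasureTheory ProbabilityTheory Filter Topology

noncomputable section

/-- The closed upper half-plane `{z ∈ ℂ : Im z ≥ 0}`. -/
def closedUpperHalfPlane : Set ℂ := {z : ℂ | 0 ≤ z.im}

/-- The generator `f_p^{(α)}(z) = (z + α)^p`, with the principal branch of the power
(and `0 ^ p = 0` for `p ≠ 0`). -/
def powerGenerator (α : ℂ) (p : ℝ) (z : ℂ) : ℂ := (z + α) ^ (p : ℂ)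

/-- The quasi-arithmetic mean `f⁻¹ ((f x₁ + ⋯ + f xₙ) / n)` of real numbers `x₁, …, xₙ`, where
`f⁻¹` is the inverse of `f` on the closed upper half-plane. (For `f = f_p^{(α)}` with `0 < p ≤ 1`
and `Im α ≥ 0`, `f` is injective there and its image is convex.) -/
def quasiArithmeticMean (f : ℂ → ℂ) {n : ℕ} (x : Fin n → ℝ) : ℂ :=
  Function.invFunOn f closedUpperHalfPlane ((∑ j, f (x j : ℂ)) / (n : ℂ))

/-- The geometric mean `∏ⱼ (xⱼ + α)^{1/n} - α`, with principal powers. -/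
def geometricMean (α : ℂ) {n : ℕ} (x : Fin n → ℝ) : ℂ :=
  (∏ j, ((x j : ℂ) + α) ^ (1 / (n : ℂ))) - α

/-- `n^{1/p} M_n^{f_p} - n M_n^{f_1}` for the generators `f_p = f_p^{(α)}`. -/
def truncatedPowerSum (α : ℂ) (p : ℝ) {n : ℕ} (x : Fin n → ℝ) : ℂ :=
  (((n : ℝ) ^ (1 / p) : ℝ) : ℂ) * quasiArithmeticMean (powerGenerator α p) x
    - (n : ℂ) * quasiArithmeticMean (powerGenerator α 1) x

/-- `(n^{1/p} M_n^{f_p} - n M_n^{f_1}) / (n^{1/p} - n)`. -/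
def truncatedPowerMean (α : ℂ) (p : ℝ) {n : ℕ} (x : Fin n → ℝ) : ℂ :=
  truncatedPowerSum α p x / ((((n : ℝ) ^ (1 / p) : ℝ) : ℂ) - (n : ℂ))

end

/-! Put zⱼ = xⱼ + α and D(z) = (∑ zⱼ^p)^{1/p} - ∑ zⱼ. Homogeneity gives n^{1/p} M^{f_p} - n M^{f_1}
= D(z) - (n^{1/p} - n) α (`truncatedPowerSum_eq`), so everything reduces to D. The subtraction is
essential: a Cauchy variable has moments only of order below 1, and D removes the part linear in the
largest entry. What remains is controlled by cross products |zᵢ|^{1-q} |zⱼ|^q with i ≠ j, for q = p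
and q = 1/3 (`norm_powerDefect_le`), which are integrable by independence.

Unbiasedness: as a function of one coordinate, D is continuous on the closed half-plane, holomorphic
inside and of sublinear growth. The Cauchy density is the Poisson kernel at γ, so integrating out
that coordinate replaces it by γ (`integral_cauchyMeasure_eq_of_holomorphic`). Doing this for all
coordinates leaves D(γ + α, …, γ + α) = (n^{1/p} - n)(γ + α).

Limit: power means tend to the geometric mean, and n^{1/p} → ∞ kills the correction, which gives
almost sure convergence. For L¹, the bound on D is split according to whether the largest entry
dominates. If it does, the constant has base (n+1)/2 < n, and after normalisation the contribution
tends to 0 in L¹, even against moments of size O(1/p). If it does not, the constant is of order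
n^{1/p}, which the normalisation cancels, leaving a fixed integrable majorant
(`tendsto_eLpNorm_one_of_dominated_add`). -/

/-- `(∑ zⱼ ^ p) ^ (1 / p) - ∑ zⱼ`. -/
noncomputable def powerDefect (p : ℝ) {n : ℕ} (z : Fin n → ℂ) : ℂ :=
  (∑ j, z j ^ (p : ℂ)) ^ ((1 / p : ℝ) : ℂ) - ∑ j, z j

/-! ### Principal powers away from branch crossings -/

lemma Complex.mul_cpow_of_pos {r : ℝ} (hr : 0 < r) (w : ℂ) (q : ℝ) (hq : q ≠ 0) :
    ((r : ℂ) * w) ^ (q : ℂ) = ((r ^ q : ℝ) : ℂ) * w ^ (q : ℂ) := by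
  have hq' : (q : ℂ) ≠ 0 := by exact_mod_cast hq
  rcases eq_or_ne w 0 with rfl | hw
  · simp [Complex.zero_cpow hq']
  have hr' : (r : ℂ) ≠ 0 := by exact_mod_cast hr.ne'
  rw [Complex.ofReal_cpow hr.le, Complex.cpow_def_of_ne_zero (mul_ne_zero hr' hw),
    Complex.cpow_def_of_ne_zero hr', Complex.cpow_def_of_ne_zero hw,
    Complex.log_ofReal_mul hr hw, ← Complex.exp_add, Complex.ofReal_log hr.le]
  ring_nf

lemma Complex.log_cpow_of_arg_mul_mem {z : ℂ} (hz : z ≠ 0) {p : ℝ}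
    (h1 : -Real.pi < p * z.arg) (h2 : p * z.arg ≤ Real.pi) :
    Complex.log (z ^ (p : ℂ)) = p * Complex.log z := by
  rw [Complex.cpow_def_of_ne_zero hz, Complex.log_exp, mul_comm]
  · simpa [Complex.mul_im, Complex.log_im, mul_comm] using h1
  · simpa [Complex.mul_im, Complex.log_im, mul_comm] using h2

lemma Complex.arg_cpow_of_arg_mul_mem {z : ℂ} (hz : z ≠ 0) {p : ℝ}
    (h1 : -Real.pi < p * z.arg) (h2 : p * z.arg ≤ Real.pi) :
    (z ^ (p : ℂ)).arg = p * z.arg := by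
  rw [← Complex.log_im, Complex.log_cpow_of_arg_mul_mem hz h1 h2]
  simp [Complex.mul_im, Complex.log_im]

lemma Complex.cpow_cpow_of_arg_mul_mem {z : ℂ} {p q : ℝ} (hp : p ≠ 0) (hq : q ≠ 0)
    (h1 : -Real.pi < p * z.arg) (h2 : p * z.arg ≤ Real.pi) :
    (z ^ (p : ℂ)) ^ (q : ℂ) = z ^ ((p * q : ℝ) : ℂ) := by
  have hp' : (p : ℂ) ≠ 0 := by exact_mod_cast hp
  have hq' : (q : ℂ) ≠ 0 := by exact_mod_cast hq
  rcases eq_or_ne z 0 with rfl | hz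
  · have : ((p * q : ℝ) : ℂ) ≠ 0 := by push_cast; exact mul_ne_zero hp' hq'
    simp [Complex.zero_cpow hp', Complex.zero_cpow hq', Complex.zero_cpow this, -Complex.ofReal_mul]
  have hzp : z ^ (p : ℂ) ≠ 0 := by simp [Complex.cpow_eq_zero_iff, hz]
  rw [Complex.cpow_def_of_ne_zero hzp, Complex.log_cpow_of_arg_mul_mem hz h1 h2,
    Complex.cpow_def_of_ne_zero hz]
  push_cast
  ring_nf

lemma arg_mul_mem_of_im_nonneg {z : ℂ} (hz : 0 ≤ z.im) {p : ℝ} (hp : 0 < p) (hp1 : p ≤ 1) :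
    0 ≤ p * z.arg ∧ p * z.arg ≤ p * Real.pi ∧ p * z.arg ≤ Real.pi := by
  have h1 := Complex.arg_nonneg_iff.2 hz
  have h2 := Complex.arg_le_pi z
  have := Real.pi_pos
  refine ⟨by positivity, by gcongr, by nlinarith⟩

lemma cpow_cpow_inv_of_im_nonneg {z : ℂ} (hz : 0 ≤ z.im) {p : ℝ} (hp : 0 < p) (hp1 : p ≤ 1) :
    (z ^ (p : ℂ)) ^ ((1 / p : ℝ) : ℂ) = z := by
  obtain ⟨h1, -, h2⟩ := arg_mul_mem_of_im_nonneg hz hp hp1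
  rw [Complex.cpow_cpow_of_arg_mul_mem hp.ne' (by positivity) (by linarith [Real.pi_pos]) h2,
    mul_one_div_cancel hp.ne']
  simp

/-! ### Convexity of the power images -/

/-- The sector `0 ≤ arg w ≤ pπ` is an intersection of two half-planes. -/
lemma arg_mem_sector_iff {p : ℝ} (hp : 0 < p) (hp1 : p < 1) (w : ℂ) :
    (0 ≤ w.arg ∧ w.arg ≤ p * Real.pi) ↔
      0 ≤ w.im ∧ 0 ≤ (Complex.exp (((1 - p) * Real.pi : ℝ) * Complex.I) * w).im := by
  have hpi := Real.pi_pos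
  rw [Complex.arg_nonneg_iff]
  refine and_congr_right fun hw => ?_
  have h0 := Complex.arg_nonneg_iff.2 hw
  have h1 := Complex.arg_le_pi w
  -- The rotation by (1 - p)π carries the edge arg w = pπ onto the negative real axis.
  have key : (Complex.exp (((1 - p) * Real.pi : ℝ) * Complex.I) * w).im
      = ‖w‖ * Real.sin ((1 - p) * Real.pi + w.arg) := by
    conv_lhs => rw [← Complex.norm_mul_exp_arg_mul_I w]
    rw [mul_left_comm, ← Complex.exp_add, ← add_mul, ← Complex.ofReal_add,
      Complex.im_ofReal_mul, Complex.exp_ofReal_mul_I_im]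
  rw [key]
  rcases eq_or_ne w 0 with rfl | hw0
  · simp; positivity
  constructor
  · intro h
    refine mul_nonneg (norm_nonneg _) (Real.sin_nonneg_of_nonneg_of_le_pi ?_ ?_) <;> nlinarith
  · intro h
    have hn : 0 < ‖w‖ := norm_pos_iff.2 hw0
    have h' : 0 ≤ Real.sin ((1 - p) * Real.pi + w.arg) := nonneg_of_mul_nonneg_right h hn
    by_contra! hlt
    have : 0 < Real.sin ((1 - p) * Real.pi + w.arg - Real.pi) :=
      Real.sin_pos_of_pos_of_lt_pi (by nlinarith) (by nlinarith)
    rw [Real.sin_sub_pi] at this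
    linarith

/-- Each summand lies in the sector of opening pπ < π, which is a convex cone. Hence the outer power
1/p never crosses the cut. -/
lemma arg_sum_cpow_mem {ι : Type*} (s : Finset ι) {p : ℝ} (hp : 0 < p) (hp1 : p < 1) {z : ι → ℂ}
    (hz : ∀ j, 0 ≤ (z j).im) :
    0 ≤ (∑ j ∈ s, z j ^ (p : ℂ)).arg ∧ (∑ j ∈ s, z j ^ (p : ℂ)).arg ≤ p * Real.pi := by
  have key : ∀ j, 0 ≤ (z j ^ (p : ℂ)).arg ∧ (z j ^ (p : ℂ)).arg ≤ p * Real.pi := by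
    intro j
    rcases eq_or_ne (z j) 0 with h | h
    · rw [h, Complex.zero_cpow (by exact_mod_cast hp.ne')]
      simp; positivity
    obtain ⟨h1, h2, h3⟩ := arg_mul_mem_of_im_nonneg (hz j) hp hp1.le
    rw [Complex.arg_cpow_of_arg_mul_mem h (by linarith [Real.pi_pos]) h3]
    exact ⟨h1, h2⟩
  rw [arg_mem_sector_iff hp hp1, Finset.mul_sum, Complex.im_sum, Complex.im_sum]
  exact ⟨Finset.sum_nonneg fun j _ => ((arg_mem_sector_iff hp hp1 _).1 (key j)).1,
    Finset.sum_nonneg fun j _ => ((arg_mem_sector_iff hp hp1 _).1 (key j)).2⟩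

lemma im_cpow_mul_cpow {u z : ℂ} (hu : u ≠ 0) (hz : z ≠ 0) (p : ℝ) :
    (u ^ ((1 - p : ℝ) : ℂ) * z ^ (p : ℂ)).im
      = ‖u‖ ^ (1 - p) * ‖z‖ ^ p * Real.sin ((1 - p) * u.arg + p * z.arg) := by
  have h : ∀ {w : ℂ} (_ : w ≠ 0) (q : ℝ),
      w ^ (q : ℂ) = ((‖w‖ ^ q : ℝ) : ℂ) * Complex.exp ((q * w.arg : ℝ) * Complex.I) := by
    intro w hw q
    rw [Complex.cpow_def_of_ne_zero hw, Complex.ofReal_cpow (norm_nonneg _),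
      Complex.cpow_def_of_ne_zero (by simpa using hw), ← Complex.exp_add,
      ← Complex.ofReal_log (norm_nonneg _)]
    congr 1
    apply Complex.ext <;> simp [Complex.log_re, Complex.log_im, mul_comm]
  rw [h hu, h hz, mul_mul_mul_comm, ← Complex.exp_add, ← add_mul, ← Complex.ofReal_mul,
    ← Complex.ofReal_add, Complex.im_ofReal_mul, Complex.exp_ofReal_mul_I_im]

lemma sin_convex_combination_le {φ θ p : ℝ} (hφ : φ ∈ Set.Icc 0 Real.pi)
    (hθ : θ ∈ Set.Icc 0 Real.pi) (hp : 0 ≤ p) (hp1 : p ≤ 1) :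
    (1 - p) * Real.sin φ + p * Real.sin θ ≤ Real.sin ((1 - p) * φ + p * θ) := by
  simpa using strictConcaveOn_sin_Icc.concaveOn.2 hφ hθ (sub_nonneg.2 hp1) hp (by ring)

/-- The image of `{Im z ≥ c}` under `z ↦ z ^ p` is closed under averages. -/
lemma le_im_powerMean {n : ℕ} (hn : n ≠ 0) {p : ℝ} (hp : 0 < p) (hp1 : p < 1) {z : Fin n → ℂ}
    {c : ℝ} (hc : 0 ≤ c) (hz : ∀ j, c ≤ (z j).im) {M : ℂ} (hM : 0 ≤ M.im)
    (hMp : M ^ (p : ℂ) = (∑ j, z j ^ (p : ℂ)) / n) : c ≤ M.im := by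
  rcases hc.eq_or_lt with rfl | hc
  · exact hM
  have hn' : (0 : ℝ) < n := by positivity
  have hne : (Finset.univ : Finset (Fin n)).Nonempty := by
    have : NeZero n := ⟨hn⟩
    exact Finset.univ_nonempty
  have hz0 : ∀ j, z j ≠ 0 := fun j h => by have := hz j; simp [h] at this; linarith
  have hargz : ∀ j, (z j).arg ∈ Set.Icc 0 Real.pi := fun j =>
    ⟨Complex.arg_nonneg_iff.2 (hc.le.trans (hz j)), Complex.arg_le_pi _⟩
  have hsinz : ∀ j, 0 < Real.sin (z j).arg := fun j => by
    rw [Complex.sin_arg]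
    exact div_pos (hc.trans_le (hz j)) (norm_pos_iff.2 (hz0 j))
  have hpi := Real.pi_pos
  have hM0 : M ≠ 0 := by
    rintro rfl
    rw [Complex.zero_cpow (by exact_mod_cast hp.ne'), eq_comm, div_eq_zero_iff] at hMp
    rcases hMp with h | h
    · have : 0 < (∑ j, z j ^ (p : ℂ)).im := by
        rw [Complex.im_sum]
        refine Finset.sum_pos (fun j _ => ?_) hne
        have := im_cpow_mul_cpow one_ne_zero (hz0 j) p
        simp only [Complex.one_cpow, one_mul, Complex.arg_one, norm_one, Real.one_rpow,
          mul_zero, zero_add] at this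
        rw [this]
        have h1 := hargz j
        have h2 : 0 < (z j).arg := by
          rcases h1.1.eq_or_lt with h | h
          · have := hsinz j; rw [← h] at this; simp at this
          · exact h
        have := norm_pos_iff.2 (hz0 j)
        exact mul_pos (by positivity) (Real.sin_pos_of_pos_of_lt_pi (by positivity)
          (by nlinarith [h1.2]))
      rw [h] at this; simp at this
    · exact hn (by exact_mod_cast h)
  have hMpos := norm_pos_iff.2 hM0
  have hargM : M.arg ∈ Set.Icc 0 Real.pi := ⟨Complex.arg_nonneg_iff.2 hM, Complex.arg_le_pi _⟩
  -- Write M = M^{1-p} · M^p and insert the average for M^p. This makes Im M an average of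
  -- quantities with a known sine.
  have hMM : M.im = (∑ j, (M ^ ((1 - p : ℝ) : ℂ) * z j ^ (p : ℂ)).im) / n := by
    rw [← Complex.im_sum, ← Finset.mul_sum, ← Complex.div_natCast_im, mul_div_assoc, ← hMp,
      ← Complex.cpow_add _ _ hM0]
    simp
  have hlow : ∀ j, ‖M‖ ^ (1 - p) * ‖z j‖ ^ p * ((1 - p) * Real.sin M.arg + p * Real.sin (z j).arg)
      ≤ (M ^ ((1 - p : ℝ) : ℂ) * z j ^ (p : ℂ)).im := by
    intro j
    rw [im_cpow_mul_cpow hM0 (hz0 j)]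
    gcongr
    exact sin_convex_combination_le hargM (hargz j) hp.le hp1.le
  have hsinM : 0 ≤ Real.sin M.arg := Real.sin_nonneg_of_nonneg_of_le_pi hargM.1 hargM.2
  have hMim : 0 < M.im := by
    rw [hMM]
    refine div_pos (Finset.sum_pos (fun j _ => lt_of_lt_of_le ?_ (hlow j)) hne) hn'
    have := norm_pos_iff.2 (hz0 j)
    have := hsinz j
    have : 0 ≤ (1 - p) * Real.sin M.arg := mul_nonneg (by linarith) hsinM
    positivity
  -- Concavity of sine, already in `hlow`, followed by weighted AM-GM. Cancelling (Im M)^{1-p} then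
  -- compares c with Im M.
  have hlow2 : M.im ^ (1 - p) * c ^ p ≤ M.im := by
    nth_rewrite 2 [hMM]
    rw [le_div_iff₀ hn']
    calc M.im ^ (1 - p) * c ^ p * n = ∑ j : Fin n, M.im ^ (1 - p) * c ^ p := by
          simp [mul_comm]
      _ ≤ _ := Finset.sum_le_sum fun j _ => le_trans ?_ (hlow j)
    have hzj := norm_pos_iff.2 (hz0 j)
    calc M.im ^ (1 - p) * c ^ p ≤ M.im ^ (1 - p) * (z j).im ^ p := by
          gcongr; exact hz j
      _ = ‖M‖ ^ (1 - p) * ‖z j‖ ^ p * (Real.sin M.arg ^ (1 - p) * Real.sin (z j).arg ^ p) := by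
          rw [← Complex.norm_mul_sin_arg M, ← Complex.norm_mul_sin_arg (z j),
            Real.mul_rpow (norm_nonneg _) hsinM, Real.mul_rpow (norm_nonneg _) (hsinz j).le]
          ring
      _ ≤ _ := by
          gcongr
          exact Real.geom_mean_le_arith_mean2_weighted (by linarith) hp.le hsinM (hsinz j).le
            (by ring)
  have h3 : c ^ p ≤ M.im ^ p := by
    have h4 : M.im ^ (1 - p) * M.im ^ p = M.im := by
      rw [← Real.rpow_add hMim]; simp
    have h5 : 0 < M.im ^ (1 - p) := by positivity
    nlinarith
  exact (Real.rpow_le_rpow_iff hc.le hMim.le hp).1 h3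

/-! ### Closed forms for the means -/

lemma powerGenerator_injOn {α : ℂ} (hα : 0 ≤ α.im) {p : ℝ} (hp : 0 < p) (hp1 : p ≤ 1) :
    Set.InjOn (powerGenerator α p) closedUpperHalfPlane := by
  intro z hz w hw h
  have hz' : 0 ≤ (z + α).im := by simpa using add_nonneg hz hα
  have hw' : 0 ≤ (w + α).im := by simpa using add_nonneg hw hα
  have := congrArg (fun u : ℂ => u ^ ((1 / p : ℝ) : ℂ)) h
  simp only [powerGenerator] at this
  rw [cpow_cpow_inv_of_im_nonneg hz' hp hp1, cpow_cpow_inv_of_im_nonneg hw' hp hp1] at this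
  exact add_right_cancel this

lemma quasiArithmeticMean_eq_of_mem {f : ℂ → ℂ} (hf : Set.InjOn f closedUpperHalfPlane) {n : ℕ}
    {x : Fin n → ℝ} {m : ℂ} (hm : m ∈ closedUpperHalfPlane)
    (h : f m = (∑ j, f (x j : ℂ)) / (n : ℂ)) : quasiArithmeticMean f x = m := by
  rw [quasiArithmeticMean, ← h]
  exact hf.leftInvOn_invFunOn hm

lemma quasiArithmeticMean_powerGenerator {α : ℂ} (hα : 0 ≤ α.im) {p : ℝ} (hp : 0 < p) (hp1 : p < 1)
    {n : ℕ} (hn : n ≠ 0) (x : Fin n → ℝ) :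
    quasiArithmeticMean (powerGenerator α p) x
      = ((∑ j, ((x j : ℂ) + α) ^ (p : ℂ)) / n) ^ ((1 / p : ℝ) : ℂ) - α := by
  set W : ℂ := (∑ j, ((x j : ℂ) + α) ^ (p : ℂ)) / n with hW
  have hn' : (0 : ℝ) < n := by positivity
  have hz : ∀ j, 0 ≤ ((x j : ℂ) + α).im := fun j => by simpa using hα
  have harg : 0 ≤ W.arg ∧ W.arg ≤ p * Real.pi := by
    have := arg_sum_cpow_mem Finset.univ hp hp1 hz
    have h2 : W = ((n : ℝ)⁻¹ : ℝ) * (∑ j, ((x j : ℂ) + α) ^ (p : ℂ)) := by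
      rw [hW]; push_cast; ring
    rwa [h2, Complex.arg_real_mul _ (by positivity)]
  have hpi := Real.pi_pos
  have h1 : 0 ≤ 1 / p * W.arg := mul_nonneg (by positivity) harg.1
  have h2 : 1 / p * W.arg ≤ Real.pi := by
    rw [one_div, inv_mul_le_iff₀ hp]; exact harg.2
  have hMp : (W ^ ((1 / p : ℝ) : ℂ)) ^ (p : ℂ) = W := by
    rw [Complex.cpow_cpow_of_arg_mul_mem (by positivity) hp.ne' (by linarith) h2,
      one_div_mul_cancel hp.ne']
    simp
  have hMim : 0 ≤ (W ^ ((1 / p : ℝ) : ℂ)).im := by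
    rcases eq_or_ne W 0 with h | h
    · rw [h, Complex.zero_cpow (by exact_mod_cast (one_div_pos.2 hp).ne')]; simp
    · rw [← Complex.arg_nonneg_iff, Complex.arg_cpow_of_arg_mul_mem h (by linarith) h2]
      exact h1
  refine quasiArithmeticMean_eq_of_mem (powerGenerator_injOn hα hp hp1.le) ?_ ?_
  -- Subtracting α must not leave the half-plane: every xⱼ + α has imaginary part Im α, hence the
  -- power mean has imaginary part at least Im α.
  · have := le_im_powerMean hn hp hp1 hα (z := fun j => (x j : ℂ) + α) (fun j => by simp) hMim hMp
    simpa [closedUpperHalfPlane] using this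
  · simp only [powerGenerator, sub_add_cancel]
    exact hMp

lemma quasiArithmeticMean_powerGenerator_one {α : ℂ} (hα : 0 ≤ α.im) {n : ℕ} (hn : n ≠ 0)
    (x : Fin n → ℝ) :
    quasiArithmeticMean (powerGenerator α 1) x = (∑ j, (x j : ℂ)) / n := by
  have hn' : (n : ℂ) ≠ 0 := by exact_mod_cast hn
  refine quasiArithmeticMean_eq_of_mem (powerGenerator_injOn hα one_pos le_rfl) ?_ ?_
  · simp [closedUpperHalfPlane]
  · simp only [powerGenerator, Complex.ofReal_one, Complex.cpow_one, Finset.sum_add_distrib]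
    field_simp
    simp

/-- The factor n^{1/p} passes inside the outer power and cancels the 1/n. The shifts by α collect
into a constant. -/
lemma truncatedPowerSum_eq {α : ℂ} (hα : 0 ≤ α.im) {p : ℝ} (hp : 0 < p) (hp1 : p < 1)
    {n : ℕ} (hn : n ≠ 0) (x : Fin n → ℝ) :
    truncatedPowerSum α p x = powerDefect p (fun j => (x j : ℂ) + α)
      - ((((n : ℝ) ^ (1 / p) : ℝ) : ℂ) - n) * α := by
  have hn' : (n : ℂ) ≠ 0 := by exact_mod_cast hn
  have hn'' : (0 : ℝ) < n := by positivity
  rw [truncatedPowerSum, quasiArithmeticMean_powerGenerator hα hp hp1 hn,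
    quasiArithmeticMean_powerGenerator_one hα hn, mul_sub,
    ← Complex.mul_cpow_of_pos hn'' _ _ (by positivity), powerDefect, Finset.sum_add_distrib,
    mul_div_cancel₀ _ hn', Complex.ofReal_natCast, mul_div_cancel₀ _ hn']
  simp
  ring

/-! ### A convex cone on which powers are smooth -/

/-- The cone of nonzero complex numbers with argument in `[0, π)`. -/
def argCone : Set ℂ := {w : ℂ | 0 < w.im ∨ w.im = 0 ∧ 0 < w.re}

lemma argCone_subset_slitPlane : argCone ⊆ Complex.slitPlane := by
  rintro w (h | h)
  · exact Or.inr h.ne'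
  · exact Or.inl h.2

lemma convex_argCone : Convex ℝ argCone := by
  intro u hu v hv a b ha hb hab
  simp only [argCone, Set.mem_ofPred_eq, Complex.add_im, Complex.add_re, Complex.real_smul,
    Complex.im_ofReal_mul, Complex.re_ofReal_mul] at *
  rcases ha.eq_or_lt with rfl | ha
  · obtain rfl : b = 1 := by linarith
    simpa using hv
  rcases hb.eq_or_lt with rfl | hb
  · obtain rfl : a = 1 := by linarith
    simpa using hu
  rcases hu with hu | ⟨hu, hu'⟩ <;> rcases hv with hv | ⟨hv, hv'⟩
  · exact Or.inl (by positivity)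
  · left; rw [hv]; simp; positivity
  · left; rw [hu]; simp; positivity
  · right; rw [hu, hv]; exact ⟨by simp, by positivity⟩

lemma mem_argCone_of_arg_lt_pi {w : ℂ} (hw : w ≠ 0) (h0 : 0 ≤ w.arg) (h1 : w.arg < Real.pi) :
    w ∈ argCone := by
  rcases (Complex.arg_nonneg_iff.1 h0).eq_or_lt with h | h
  · refine Or.inr ⟨h.symm, ?_⟩
    have := (Complex.arg_lt_pi_iff.1 h1).resolve_right (by simp [← h])
    refine this.lt_of_ne fun h' => hw (Complex.ext h'.symm h.symm)
  · exact Or.inl h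

lemma cpow_mem_argCone {z : ℂ} (hz : 0 ≤ z.im) (hz0 : z ≠ 0) {p : ℝ} (hp : 0 < p) (hp1 : p < 1) :
    z ^ (p : ℂ) ∈ argCone := by
  obtain ⟨h1, h2, h3⟩ := arg_mul_mem_of_im_nonneg hz hp hp1.le
  have hpi := Real.pi_pos
  refine mem_argCone_of_arg_lt_pi (by simp [Complex.cpow_eq_zero_iff, hz0]) ?_ ?_ <;>
    rw [Complex.arg_cpow_of_arg_mul_mem hz0 (by linarith) h3]
  · exact h1
  · nlinarith

lemma add_mem_argCone {u v : ℂ} (hu : u ∈ argCone) (hv0 : 0 ≤ v.arg) (hv : v.arg < Real.pi) :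
    u + v ∈ argCone := by
  rcases eq_or_ne v 0 with rfl | h
  · simpa using hu
  have hv' := mem_argCone_of_arg_lt_pi h hv0 hv
  simp only [argCone, Set.mem_ofPred_eq, Complex.add_im, Complex.add_re] at *
  rcases hu with hu | ⟨hu, hu'⟩ <;> rcases hv' with hv | ⟨hv, hv'⟩
  · exact Or.inl (by positivity)
  · left; rw [hv]; simpa
  · left; rw [hu]; simpa
  · right; rw [hu, hv]; exact ⟨by simp, by positivity⟩

/-- Mean value inequality on the cone cut by a ball, a convex set inside the slit plane where the
derivative q w^{q-1} is bounded. -/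
lemma norm_cpow_sub_cpow_le {u v : ℂ} (hu : u ∈ argCone) (hv : v ∈ argCone) {q ρ : ℝ} (hq : 1 ≤ q)
    (huρ : ‖u‖ ≤ ρ) (hvρ : ‖v‖ ≤ ρ) :
    ‖v ^ (q : ℂ) - u ^ (q : ℂ)‖ ≤ q * ρ ^ (q - 1) * ‖v - u‖ := by
  have hs : Convex ℝ (argCone ∩ Metric.closedBall 0 ρ) :=
    convex_argCone.inter (convex_closedBall 0 ρ)
  refine hs.norm_image_sub_le_of_norm_hasDerivWithin_le (f := fun w : ℂ => w ^ (q : ℂ))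
    (f' := fun w : ℂ => q * w ^ ((q : ℂ) - 1)) ?_ ?_ ⟨hu, by simpa using huρ⟩
    ⟨hv, by simpa using hvρ⟩
  · intro w hw
    exact (Complex.hasStrictDerivAt_cpow_const
      (argCone_subset_slitPlane hw.1)).hasDerivAt.hasDerivWithinAt
  · intro w hw
    have h1 : ((q : ℂ) - 1) = ((q - 1 : ℝ) : ℂ) := by push_cast; ring
    rw [h1, norm_mul, Complex.norm_cpow_real, Complex.norm_real, Real.norm_eq_abs,
      abs_of_nonneg (by linarith)]
    have : ‖w‖ ≤ ρ := by simpa using hw.2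
    gcongr

/-! ### Cross moments and the bound on the defect -/

/-- `∑_{i ≠ j} aᵢ ^ (1 - p) aⱼ ^ p`. -/
noncomputable def crossMoment (p : ℝ) {n : ℕ} (a : Fin n → ℝ) : ℝ :=
  ∑ i, ∑ j ∈ Finset.univ.erase i, a i ^ (1 - p) * a j ^ p

lemma sum_le_crossMoment (p : ℝ) {n : ℕ} {a : Fin n → ℝ} (ha : ∀ i, 0 ≤ a i) (i : Fin n) :
    ∑ j ∈ Finset.univ.erase i, a i ^ (1 - p) * a j ^ p ≤ crossMoment p a := by
  refine Finset.single_le_sum (f := fun i => ∑ j ∈ Finset.univ.erase i, a i ^ (1 - p) * a j ^ p)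
    (fun k _ => Finset.sum_nonneg fun j _ => ?_) (Finset.mem_univ i)
  have := ha k; have := ha j; positivity

lemma le_crossMoment (p : ℝ) {n : ℕ} {a : Fin n → ℝ} (ha : ∀ i, 0 ≤ a i) {i j : Fin n}
    (hij : j ≠ i) : a i ^ (1 - p) * a j ^ p ≤ crossMoment p a := by
  refine le_trans ?_ (sum_le_crossMoment p ha i)
  refine Finset.single_le_sum (f := fun j => a i ^ (1 - p) * a j ^ p)
    (fun k _ => ?_) (Finset.mem_erase.2 ⟨hij, Finset.mem_univ j⟩)
  have := ha k; have := ha i; positivity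

lemma crossMoment_nonneg (p : ℝ) {n : ℕ} {a : Fin n → ℝ} (ha : ∀ i, 0 ≤ a i) :
    0 ≤ crossMoment p a :=
  Finset.sum_nonneg fun i _ => Finset.sum_nonneg fun j _ =>
    mul_nonneg (Real.rpow_nonneg (ha i) _) (Real.rpow_nonneg (ha j) _)

/-- With t = y^{1/3} the claim is (1 - t)(t² + t - 1) ≥ 0, and t ≥ 7/10 suffices. The exponent has
to be below 1/2 for the inequality to hold near y = 1. Having no constant factor here matters, since
the bound is later raised to the power 1/p. -/
lemma half_add_le_rpow_third {y : ℝ} (hy : 1 / 2 ≤ y) (hy1 : y ≤ 1) :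
    (1 + y) / 2 ≤ y ^ (1 / 3 : ℝ) := by
  set t := y ^ (1 / 3 : ℝ) with ht
  have hy0 : 0 ≤ y := by linarith
  have ht0 : 0 ≤ t := by positivity
  have h3 : t ^ 3 = y := by
    rw [ht, ← Real.rpow_natCast, ← Real.rpow_mul hy0]; norm_num
  have ht1 : t ≤ 1 := Real.rpow_le_one hy0 hy1 (by norm_num)
  have ht2 : 7 / 10 ≤ t := by
    by_contra! h
    have : t ^ 3 < (7 / 10) ^ 3 := by gcongr
    rw [h3] at this; norm_num at this; linarith
  rw [← h3]
  nlinarith [mul_nonneg (sub_nonneg.2 ht1) (by nlinarith : 0 ≤ t ^ 2 + t - 1)]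

lemma norm_sum_cpow_le {p : ℝ} {ι : Type*} (s : Finset ι) (z : ι → ℂ) :
    ‖∑ j ∈ s, z j ^ (p : ℂ)‖ ≤ ∑ j ∈ s, ‖z j‖ ^ p :=
  (norm_sum_le _ _).trans (Finset.sum_le_sum fun _ _ => (Complex.norm_cpow_real _ _).le)

/-- Bound when the largest entry dominates the others. -/
lemma norm_powerDefect_le_of_dominant {p : ℝ} (hp : 0 < p) (hp1 : p < 1) {n : ℕ}
    {z : Fin n → ℂ} (hz : ∀ j, 0 ≤ (z j).im) (i : Fin n) (hi : ∀ j, ‖z j‖ ≤ ‖z i‖)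
    (hi0 : z i ≠ 0)
    (hR : ∑ j ∈ Finset.univ.erase i, ‖z j‖ ^ p ≤ ((n : ℝ) - 1) / 2 * ‖z i‖ ^ p) :
    ‖powerDefect p z‖ ≤ 2 / p * (((n : ℝ) + 1) / 2) ^ (1 / p) * crossMoment p (fun j => ‖z j‖) := by
  set A := ‖z i‖ with hA
  set R := ∑ j ∈ Finset.univ.erase i, ‖z j‖ ^ p with hRdef
  have hA0 : 0 < A := norm_pos_iff.2 hi0
  have hn1 : (1 : ℝ) ≤ n := by exact_mod_cast Fin.pos i
  have hR0 : 0 ≤ R := Finset.sum_nonneg fun _ _ => by positivity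
  have hpi := Real.pi_pos
  have hq : 1 ≤ 1 / p := by rw [le_div_iff₀ hp]; linarith
  have hS : ∑ j, z j ^ (p : ℂ) = z i ^ (p : ℂ) + ∑ j ∈ Finset.univ.erase i, z j ^ (p : ℂ) :=
    (Finset.add_sum_erase _ _ (Finset.mem_univ i)).symm
  have hS' : ∑ j, z j = z i + ∑ j ∈ Finset.univ.erase i, z j :=
    (Finset.add_sum_erase _ _ (Finset.mem_univ i)).symm
  have hu := cpow_mem_argCone (hz i) hi0 hp hp1
  have hr := arg_sum_cpow_mem (Finset.univ.erase i) hp hp1 hz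
  have hv := add_mem_argCone hu hr.1 (by nlinarith [hr.2])
  have hrR := norm_sum_cpow_le (p := p) (Finset.univ.erase i) z
  rw [← hRdef] at hrR
  have hui : ‖z i ^ (p : ℂ)‖ = A ^ p := Complex.norm_cpow_real _ _
  -- The threshold (n-1)/2 is chosen for this: the base (n+1)/2 is strictly smaller than n.
  have hAR : A ^ p + R ≤ A ^ p * ((n + 1) / 2) := by linarith
  -- Compares the outer power at zᵢ^p and at the full sum. Its value at zᵢ^p is zᵢ, which cancels
  -- the dominant entry.
  have h1 := norm_cpow_sub_cpow_le hu hv hq (ρ := A ^ p + R) (by rw [hui]; linarith)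
    ((norm_add_le _ _).trans (by rw [hui]; linarith))
  rw [cpow_cpow_inv_of_im_nonneg (hz i) hp hp1.le, add_sub_cancel_left] at h1
  have hK : 1 ≤ (((n : ℝ) + 1) / 2) ^ (1 / p) :=
    Real.one_le_rpow (by linarith) (by positivity)
  have h2 : (A ^ p + R) ^ (1 / p - 1) ≤ A ^ (1 - p) * (((n : ℝ) + 1) / 2) ^ (1 / p) := by
    calc (A ^ p + R) ^ (1 / p - 1) ≤ (A ^ p * ((n + 1) / 2)) ^ (1 / p - 1) := by
          gcongr
      _ = A ^ (1 - p) * (((n : ℝ) + 1) / 2) ^ (1 / p - 1) := by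
          rw [Real.mul_rpow (by positivity) (by positivity), ← Real.rpow_mul hA0.le]
          congr 2
          field_simp
      _ ≤ _ := by
          gcongr
          · linarith
          · linarith
  have h3 : ∑ j ∈ Finset.univ.erase i, ‖z j‖ ≤ A ^ (1 - p) * R := by
    rw [hRdef, Finset.mul_sum]
    refine Finset.sum_le_sum fun j _ => ?_
    rcases (norm_nonneg (z j)).eq_or_lt with h | h
    · rw [← h]; positivity
    · calc ‖z j‖ = ‖z j‖ ^ (1 - p) * ‖z j‖ ^ p := by rw [← Real.rpow_add h]; simp
        _ ≤ _ := by gcongr; exact hi j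
  have hQ : A ^ (1 - p) * R ≤ crossMoment p (fun j => ‖z j‖) := by
    rw [hRdef, Finset.mul_sum]
    exact sum_le_crossMoment p (a := fun j => ‖z j‖) (fun _ => norm_nonneg _) i
  set K := (((n : ℝ) + 1) / 2) ^ (1 / p)
  have hAR0 : 0 ≤ A ^ (1 - p) * R := by positivity
  calc ‖powerDefect p z‖
      = ‖((z i ^ (p : ℂ) + ∑ j ∈ Finset.univ.erase i, z j ^ (p : ℂ)) ^ ((1 / p : ℝ) : ℂ) - z i)
          - ∑ j ∈ Finset.univ.erase i, z j‖ := by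
        rw [powerDefect, hS, hS']; congr 1; ring
    _ ≤ 1 / p * (A ^ p + R) ^ (1 / p - 1) * ‖∑ j ∈ Finset.univ.erase i, z j ^ (p : ℂ)‖
          + ∑ j ∈ Finset.univ.erase i, ‖z j‖ :=
        (norm_sub_le _ _).trans (add_le_add h1 (norm_sum_le _ _))
    _ ≤ 1 / p * (A ^ (1 - p) * K) * R + A ^ (1 - p) * R := by gcongr
    _ = (1 / p * K + 1) * (A ^ (1 - p) * R) := by ring
    _ ≤ (2 / p * K) * (A ^ (1 - p) * R) := by
        gcongr
        have : 1 ≤ 1 / p * K := by nlinarith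
        have : 2 / p * K = 2 * (1 / p * K) := by ring
        linarith
    _ ≤ _ := by gcongr

/-- Bound when the largest entry does not dominate the others. -/
lemma norm_powerDefect_le_of_not_dominant {p : ℝ} (hp : 0 < p) {n : ℕ} (hn : 2 ≤ n)
    {z : Fin n → ℂ} (i : Fin n) (hi : ∀ j, ‖z j‖ ≤ ‖z i‖) (hi0 : z i ≠ 0)
    (hR : ((n : ℝ) - 1) / 2 * ‖z i‖ ^ p < ∑ j ∈ Finset.univ.erase i, ‖z j‖ ^ p) :
    ‖powerDefect p z‖
      ≤ ((n : ℝ) + 1) * (n : ℝ) ^ (1 / p) * crossMoment (1 / 3) (fun j => ‖z j‖) := by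
  set A := ‖z i‖ with hA
  set R := ∑ j ∈ Finset.univ.erase i, ‖z j‖ ^ p with hRdef
  have hA0 : 0 < A := norm_pos_iff.2 hi0
  have hn2 : (2 : ℝ) ≤ n := by exact_mod_cast hn
  have hR0 : 0 ≤ R := Finset.sum_nonneg fun _ _ => by positivity
  have hne : (Finset.univ.erase i).Nonempty := by
    rw [← Finset.card_pos, Finset.card_erase_of_mem (Finset.mem_univ i)]
    simp; omega
  obtain ⟨k, hk, hkmax⟩ := Finset.exists_max_image (Finset.univ.erase i) (fun j => ‖z j‖) hne
  set B := ‖z k‖ with hB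
  have hRB : R ≤ (n - 1) * B ^ p := by
    calc R ≤ ∑ j ∈ Finset.univ.erase i, B ^ p :=
          Finset.sum_le_sum fun j hj => by gcongr; exact hkmax j hj
      _ = (n - 1) * B ^ p := by
          rw [Finset.sum_const, Finset.card_erase_of_mem (Finset.mem_univ i)]
          simp [Nat.cast_sub (show 1 ≤ n by omega)]
  have hAp : 0 < A ^ p := by positivity
  set y := (B / A) ^ p with hy
  have hyB : B ^ p = A ^ p * y := by
    rw [hy, ← Real.mul_rpow hA0.le (by positivity), mul_div_cancel₀ _ hA0.ne']
  have hy1 : y ≤ 1 := Real.rpow_le_one (by positivity) ((div_le_one hA0).2 (hi k)) hp.le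
  -- B is the second largest modulus. If (B/A)^p were below 1/2, the others could not sum past the
  -- threshold.
  have hy2 : 1 / 2 ≤ y := by
    have : ((n : ℝ) - 1) / 2 * A ^ p < (n - 1) * (A ^ p * y) := hyB ▸ hR.trans_le hRB
    have h' : 0 < ((n : ℝ) - 1) * A ^ p := mul_pos (by linarith) hAp
    by_contra! h
    nlinarith
  -- Since y ≤ 1, 1 + (n-1)y ≤ n(1+y)/2. After the power 1/p this becomes n^{1/p} A^{2/3} B^{1/3}, a
  -- cross term whose exponents do not depend on p.
  have h1 : A ^ p + R ≤ n * (A ^ p * y ^ (1 / 3 : ℝ)) := by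
    calc A ^ p + R ≤ A ^ p * (1 + (n - 1) * y) := by rw [hyB] at hRB; linarith
      _ ≤ A ^ p * (n * ((1 + y) / 2)) := by gcongr; nlinarith
      _ ≤ A ^ p * (n * y ^ (1 / 3 : ℝ)) := by gcongr; exact half_add_le_rpow_third hy2 hy1
      _ = _ := by ring
  have h2 : (A ^ p + R) ^ (1 / p) ≤ (n : ℝ) ^ (1 / p) * (A ^ (1 - 1 / 3 : ℝ) * B ^ (1 / 3 : ℝ)) := by
    calc (A ^ p + R) ^ (1 / p) ≤ (n * (A ^ p * y ^ (1 / 3 : ℝ))) ^ (1 / p) := by gcongr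
      _ = (n : ℝ) ^ (1 / p) * (A * (B / A) ^ (1 / 3 : ℝ)) := by
          rw [Real.mul_rpow (by positivity) (by positivity),
            Real.mul_rpow (by positivity) (by positivity), ← Real.rpow_mul hA0.le,
            mul_one_div_cancel hp.ne', Real.rpow_one, hy, ← Real.rpow_mul (by positivity),
            ← Real.rpow_mul (by positivity), show p * (1 / 3 * (1 / p)) = 1 / 3 by field_simp]
      _ = _ := by
          rw [Real.div_rpow (by positivity) hA0.le, Real.rpow_sub hA0, Real.rpow_one]
          ring
  have h3 : A ≤ (A ^ p + R) ^ (1 / p) := by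
    calc A = (A ^ p) ^ (1 / p) := by
          rw [← Real.rpow_mul hA0.le, mul_one_div_cancel hp.ne', Real.rpow_one]
      _ ≤ _ := by gcongr; linarith
  have hS : ‖∑ j, z j ^ (p : ℂ)‖ ≤ A ^ p + R := by
    refine (norm_sum_cpow_le _ _).trans (le_of_eq ?_)
    rw [← Finset.add_sum_erase _ _ (Finset.mem_univ i)]
  have hS' : ‖∑ j, z j‖ ≤ n * A := by
    refine (norm_sum_le _ _).trans ((Finset.sum_le_sum fun j _ => hi j).trans ?_)
    simp
  calc ‖powerDefect p z‖ ≤ (A ^ p + R) ^ (1 / p) + n * A := by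
        refine (norm_sub_le _ _).trans (add_le_add ?_ hS')
        rw [Complex.norm_cpow_real]
        gcongr
    _ ≤ (n + 1) * (A ^ p + R) ^ (1 / p) := by nlinarith
    _ ≤ (n + 1) * ((n : ℝ) ^ (1 / p) * (A ^ (1 - 1 / 3 : ℝ) * B ^ (1 / 3 : ℝ))) := by gcongr
    _ ≤ (n + 1) * ((n : ℝ) ^ (1 / p) * crossMoment (1 / 3) (fun j => ‖z j‖)) := by
        gcongr
        exact le_crossMoment (1 / 3) (a := fun j => ‖z j‖) (fun _ => norm_nonneg _)
          (Finset.ne_of_mem_erase hk)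
    _ = _ := by ring

lemma norm_powerDefect_le {p : ℝ} (hp : 0 < p) (hp1 : p < 1) {n : ℕ} (hn : 2 ≤ n)
    {z : Fin n → ℂ} (hz : ∀ j, 0 ≤ (z j).im) :
    ‖powerDefect p z‖ ≤ 2 / p * (((n : ℝ) + 1) / 2) ^ (1 / p) * crossMoment p (fun j => ‖z j‖)
      + ((n : ℝ) + 1) * (n : ℝ) ^ (1 / p) * crossMoment (1 / 3) (fun j => ‖z j‖) := by
  have : NeZero n := ⟨by omega⟩
  have hQ := fun q => crossMoment_nonneg q (a := fun j => ‖z j‖) fun _ => norm_nonneg _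
  have h1 : 0 ≤ 2 / p * (((n : ℝ) + 1) / 2) ^ (1 / p) * crossMoment p (fun j => ‖z j‖) :=
    mul_nonneg (by positivity) (hQ _)
  have h2 : 0 ≤ ((n : ℝ) + 1) * (n : ℝ) ^ (1 / p) * crossMoment (1 / 3) (fun j => ‖z j‖) :=
    mul_nonneg (by positivity) (hQ _)
  obtain ⟨i, -, hi⟩ := Finset.exists_max_image Finset.univ (fun j => ‖z j‖) Finset.univ_nonempty
  replace hi := fun j => hi j (Finset.mem_univ j)
  rcases eq_or_ne (z i) 0 with h0 | h0
  · have hz0 : ∀ j, z j = 0 := fun j => by have := hi j; simpa [h0] using this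
    have : powerDefect p z = 0 := by
      simp [powerDefect, hz0, Complex.zero_cpow, hp.ne']
    rw [this, norm_zero]
    positivity
  rcases le_or_gt (∑ j ∈ Finset.univ.erase i, ‖z j‖ ^ p) (((n : ℝ) - 1) / 2 * ‖z i‖ ^ p) with h | h
  · exact (norm_powerDefect_le_of_dominant hp hp1 hz i hi h0 h).trans (by linarith)
  · exact (norm_powerDefect_le_of_not_dominant hp hn i hi h0 h).trans (by linarith)

/-! ### Mean value property of the Cauchy distribution -/

/-- Cauchy's theorem on the half-plane for functions decaying faster than `1 / |z|`. -/
lemma integral_eq_zero_of_halfPlane {q : ℂ → ℂ} (hc : ContinuousOn q closedUpperHalfPlane)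
    (hd : DifferentiableOn ℂ q {z : ℂ | 0 < z.im}) {C s R₀ : ℝ} (hs : s < 1)
    (hq : ∀ z ∈ closedUpperHalfPlane, R₀ ≤ ‖z‖ → ‖q z‖ ≤ C * ‖z‖ ^ (s - 2))
    (hi : Integrable (fun x : ℝ => q x)) : ∫ x : ℝ, q x = 0 := by
  have hlim := intervalIntegral_tendsto_integral hi tendsto_neg_atTop_atBot tendsto_id
  have hzero : Tendsto (fun R : ℝ => ∫ x in (-R)..R, q x) atTop (𝓝 0) := by
    rw [tendsto_zero_iff_norm_tendsto_zero]
    have hbound : Tendsto (fun R : ℝ => 4 * |C| * R ^ (s - 1)) atTop (𝓝 0) := by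
      have := (tendsto_rpow_neg_atTop (y := 1 - s) (by linarith)).const_mul (4 * |C|)
      simpa using this
    refine squeeze_zero' (Eventually.of_forall fun _ => norm_nonneg _) ?_ hbound
    filter_upwards [eventually_ge_atTop (max R₀ 1)] with R hR
    have hR0 : R₀ ≤ R := (le_max_left _ _).trans hR
    have hR1 : 0 < R := lt_of_lt_of_le one_pos ((le_max_right _ _).trans hR)
    have hside : ∀ z : ℂ, 0 ≤ z.im → R ≤ ‖z‖ → ‖q z‖ ≤ |C| * R ^ (s - 2) := by
      intro z hz hRz
      refine (hq z hz (hR0.trans hRz)).trans ?_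
      have h1 : ‖z‖ ^ (s - 2) ≤ R ^ (s - 2) :=
        Real.rpow_le_rpow_of_nonpos hR1 hRz (by linarith)
      have h2 : 0 ≤ ‖z‖ ^ (s - 2) := by positivity
      calc C * ‖z‖ ^ (s - 2) ≤ |C| * ‖z‖ ^ (s - 2) := by gcongr; exact le_abs_self C
        _ ≤ _ := by gcongr
    -- The contour is [-R, R] × [0, R]. The other three sides have total length 4R and carry an
    -- integrand O(R^{s-2}).
    have hrect := Complex.integral_boundary_rect_eq_zero_of_continuousOn_of_differentiableOn q
      (-R : ℂ) (R + R * Complex.I) ?_ ?_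
    rotate_left
    · refine hc.mono fun z hz => ?_
      have := hz.2
      simp [Set.uIcc_of_le hR1.le] at this
      exact this.1
    · refine hd.mono fun z hz => ?_
      have := hz.2
      simp [hR1.le] at this
      exact this.1
    simp only [Complex.neg_re, Complex.ofReal_re, Complex.add_re, Complex.mul_re, Complex.I_re,
      mul_zero, Complex.ofReal_im, Complex.I_im, mul_one, sub_self, add_zero, Complex.neg_im,
      neg_zero, Complex.ofReal_zero, zero_mul, Complex.add_im, Complex.mul_im, zero_add] at hrect
    have htop : ‖∫ x in (-R)..R, q (x + R * Complex.I)‖ ≤ |C| * R ^ (s - 2) * |R - -R| := by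
      refine intervalIntegral.norm_integral_le_of_norm_le_const fun x _ => hside _ ?_ ?_
      · simp [hR1.le]
      · refine le_trans ?_ (Complex.abs_im_le_norm _)
        simp [abs_of_pos hR1]
    have hright : ‖∫ y in (0)..R, q (R + y * Complex.I)‖ ≤ |C| * R ^ (s - 2) * |R - 0| := by
      refine intervalIntegral.norm_integral_le_of_norm_le_const fun y hy => hside _ ?_ ?_
      · rw [Set.uIoc_of_le hR1.le] at hy
        simp [hy.1.le]
      · refine le_trans ?_ (Complex.abs_re_le_norm _)
        simp [abs_of_pos hR1]
    have hleft : ‖∫ y in (0)..R, q (((-R : ℝ) : ℂ) + y * Complex.I)‖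
        ≤ |C| * R ^ (s - 2) * |R - 0| := by
      refine intervalIntegral.norm_integral_le_of_norm_le_const fun y hy => hside _ ?_ ?_
      · rw [Set.uIoc_of_le hR1.le] at hy
        simp [hy.1.le]
      · refine le_trans ?_ (Complex.abs_re_le_norm _)
        simp [abs_of_pos hR1]
    have heq : ∫ x in (-R)..R, q x = (∫ x in (-R)..R, q (x + R * Complex.I))
        - Complex.I • (∫ y in (0)..R, q (R + y * Complex.I))
        + Complex.I • (∫ y in (0)..R, q (((-R : ℝ) : ℂ) + y * Complex.I)) := by
      rw [← sub_eq_zero, ← hrect]; ring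
    rw [heq]
    refine (norm_add_le _ _).trans ((add_le_add (norm_sub_le _ _) le_rfl).trans ?_)
    simp only [norm_smul, Complex.norm_I, one_mul]
    have habs : |R - -R| = 2 * R := by rw [abs_of_pos] <;> linarith
    have hpow : R ^ (s - 1) = R ^ (s - 2) * R := by
      rw [← Real.rpow_add_one hR1.ne']; ring_nf
    rw [habs] at htop
    rw [sub_zero, abs_of_pos hR1] at hright hleft
    rw [hpow]
    linarith
  exact tendsto_nhds_unique hlim hzero

lemma integrable_cauchyMeasure_iff {E : Type*} [NormedAddCommGroup E] [NormedSpace ℝ E] (x₀ : ℝ)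
    {σ : NNReal} (hσ : σ ≠ 0) {f : ℝ → E} :
    Integrable f (cauchyMeasure x₀ σ) ↔ Integrable (fun x => cauchyPDFReal x₀ σ x • f x) := by
  rw [cauchyMeasure_of_scale_ne_zero x₀ hσ, integrable_withDensity_iff_integrable_smul'
    (measurable_cauchyPDF _ _) (by simp [cauchyPDF])]
  simp [cauchyPDF, (cauchyPDF_pos x₀ hσ _).le]

lemma integral_cauchyMeasure {E : Type*} [NormedAddCommGroup E] [NormedSpace ℝ E] (x₀ : ℝ)
    {σ : NNReal} (hσ : σ ≠ 0) (f : ℝ → E) :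
    ∫ x, f x ∂(cauchyMeasure x₀ σ) = ∫ x, cauchyPDFReal x₀ σ x • f x := by
  rw [cauchyMeasure_of_scale_ne_zero x₀ hσ, integral_withDensity_eq_integral_toReal_smul
    (measurable_cauchyPDF _ _) (by simp [cauchyPDF])]
  simp [cauchyPDF, (cauchyPDF_pos x₀ hσ _).le]

lemma cauchyPDFReal_le (x₀ : ℝ) {σ : NNReal} (hσ : σ ≠ 0) :
    ∃ K : ℝ, 0 < K ∧ ∀ x, cauchyPDFReal x₀ σ x ≤ K * (1 + |x|) ^ (-2 : ℝ) := by
  have hσ' : (0 : ℝ) < σ := by positivity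
  set K := 2 * (1 + |x₀|) ^ 2 / (σ : ℝ) ^ 2 + 2 with hK
  refine ⟨Real.pi⁻¹ * σ * K, by positivity, fun x => ?_⟩
  have hD : 0 < (x - x₀) ^ 2 + (σ : ℝ) ^ 2 := by positivity
  have h1 : (1 + |x|) ^ 2 ≤ K * ((x - x₀) ^ 2 + (σ : ℝ) ^ 2) := by
    have h2 : 1 + |x| ≤ (1 + |x₀|) + |x - x₀| := by
      have := abs_add_le (x - x₀) x₀
      rw [sub_add_cancel] at this; linarith
    have h3 : (1 + |x|) ^ 2 ≤ ((1 + |x₀|) + |x - x₀|) ^ 2 := by gcongr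
    have h4 : ((1 + |x₀|) + |x - x₀|) ^ 2 ≤ 2 * (1 + |x₀|) ^ 2 + 2 * (x - x₀) ^ 2 := by
      rw [← sq_abs (x - x₀)]; nlinarith [sq_nonneg ((1 + |x₀|) - |x - x₀|)]
    have h5 : K * ((x - x₀) ^ 2 + (σ : ℝ) ^ 2) = 2 * (1 + |x₀|) ^ 2 + 2 * (x - x₀) ^ 2
        + (2 * (1 + |x₀|) ^ 2 / (σ : ℝ) ^ 2 * (x - x₀) ^ 2 + 2 * (σ : ℝ) ^ 2) := by
      rw [hK]; field_simp; ring
    have h6 : 0 ≤ 2 * (1 + |x₀|) ^ 2 / (σ : ℝ) ^ 2 * (x - x₀) ^ 2 + 2 * (σ : ℝ) ^ 2 := by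
      positivity
    linarith
  have hx : 0 < 1 + |x| := by positivity
  rw [cauchyPDFReal_def, mul_assoc _ K]
  gcongr
  rw [Real.rpow_neg hx.le, Real.rpow_two, inv_le_iff_one_le_mul₀ hD, ← div_eq_mul_inv, mul_comm,
    mul_div_assoc', le_div_iff₀ (by positivity), one_mul, mul_comm]
  exact h1

lemma integral_one_add_abs_rpow {p : ℝ} (hp : 0 < p) :
    ∫ x : ℝ, (1 + |x|) ^ (-(1 + p)) = 2 / p := by
  rw [integral_comp_abs (f := fun x : ℝ => (1 + x) ^ (-(1 + p)))]
  have h := integral_Ioi_rpow_of_lt (a := -(1 + p)) (by linarith) (c := 1) one_pos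
  have h2 : ∫ x in Set.Ioi (0 : ℝ), (1 + x) ^ (-(1 + p)) = ∫ x in Set.Ioi (1 : ℝ), x ^ (-(1 + p)) := by
    have := (measurePreserving_add_left volume (1 : ℝ)).setIntegral_preimage_emb
      (MeasurableEquiv.addLeft (1 : ℝ)).measurableEmbedding (fun x => x ^ (-(1 + p))) (Set.Ioi 1)
    simpa [Set.preimage_const_add_Ioi] using this
  rw [h2, h]
  simp
  field_simp

lemma integrable_one_add_abs_rpow {p : ℝ} (hp : 0 < p) :
    Integrable (fun x : ℝ => (1 + |x|) ^ (-(1 + p))) := by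
  simpa using integrable_one_add_norm (E := ℝ) (μ := volume) (r := 1 + p) (by simp [hp])

/-- Moments of order `1 - p` of the Cauchy distribution are `O(1 / p)`. -/
lemma cauchyMeasure_moment (x₀ : ℝ) {σ : NNReal} (hσ : σ ≠ 0) :
    ∃ K : ℝ, 0 < K ∧ ∀ p : ℝ, 0 < p →
      Integrable (fun x => (1 + |x|) ^ (1 - p)) (cauchyMeasure x₀ σ) ∧
      ∫ x, (1 + |x|) ^ (1 - p) ∂(cauchyMeasure x₀ σ) ≤ K / p := by
  obtain ⟨K, hK, hle⟩ := cauchyPDFReal_le x₀ hσ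
  refine ⟨K * 2, by positivity, fun p hp => ?_⟩
  have hbd : ∀ x : ℝ, cauchyPDFReal x₀ σ x • (1 + |x|) ^ (1 - p) ≤ K * (1 + |x|) ^ (-(1 + p)) := by
    intro x
    have hx : 0 < 1 + |x| := by positivity
    have : (1 + |x|) ^ (-(1 + p)) = (1 + |x|) ^ (-2 : ℝ) * (1 + |x|) ^ (1 - p) := by
      rw [← Real.rpow_add hx]; ring_nf
    rw [this, smul_eq_mul, ← mul_assoc]
    gcongr
    exact hle x
  have hnn : ∀ x : ℝ, 0 ≤ cauchyPDFReal x₀ σ x • (1 + |x|) ^ (1 - p) := fun x =>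
    mul_nonneg (cauchyPDF_pos x₀ hσ x).le (by positivity)
  have hint := (integrable_one_add_abs_rpow hp).const_mul K
  have hi : Integrable (fun x : ℝ => cauchyPDFReal x₀ σ x • (1 + |x|) ^ (1 - p)) := by
    refine hint.mono' ?_ (ae_of_all _ fun x => ?_)
    · refine Measurable.aestronglyMeasurable ?_
      have := measurable_cauchyPDFReal x₀ σ
      simp only [smul_eq_mul]
      fun_prop
    · rw [Real.norm_of_nonneg (hnn x)]; exact hbd x
  refine ⟨(integrable_cauchyMeasure_iff x₀ hσ).2 hi, ?_⟩
  rw [integral_cauchyMeasure x₀ hσ]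
  calc _ ≤ ∫ x, K * (1 + |x|) ^ (-(1 + p)) := integral_mono hi hint hbd
    _ = K * 2 / p := by rw [integral_const_mul, integral_one_add_abs_rpow hp]; ring

/-- Mean value property of the Cauchy distribution for functions of sublinear growth which are
holomorphic on the upper half-plane and continuous on its closure. -/
lemma integral_cauchyMeasure_eq_of_holomorphic {γ : ℂ} (hγ : 0 < γ.im) {h : ℂ → ℂ}
    (hc : ContinuousOn h closedUpperHalfPlane) (hd : DifferentiableOn ℂ h {z : ℂ | 0 < z.im})
    {C s : ℝ} (hs0 : 0 ≤ s) (hs : s < 1)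
    (hb : ∀ z ∈ closedUpperHalfPlane, ‖h z‖ ≤ C * (1 + ‖z‖) ^ s) :
    ∫ x : ℝ, h x ∂(cauchyMeasure γ.re ⟨γ.im, hγ.le⟩) = h γ := by
  set σ : NNReal := ⟨γ.im, hγ.le⟩ with hσdef
  have hσ : σ ≠ 0 := by
    intro h; have := congrArg NNReal.toReal h; simp [hσdef] at this; exact hγ.ne' this
  have hopen : IsOpen {z : ℂ | 0 < z.im} := isOpen_lt continuous_const Complex.continuous_im
  have hsub : {z : ℂ | 0 < z.im} ⊆ closedUpperHalfPlane :=
    fun z (hz : 0 < z.im) => show 0 ≤ z.im from hz.le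
  have hC : 0 ≤ C := by
    have := (norm_nonneg _).trans (hb γ hγ.le)
    exact nonneg_of_mul_nonneg_left this (by positivity)
  have hreal : ∀ x : ℝ, (x : ℂ) ∈ closedUpperHalfPlane := fun x => by simp [closedUpperHalfPlane]
  have hcont : Continuous fun x : ℝ => h x :=
    hc.comp_continuous Complex.continuous_ofReal hreal
  have hint : Integrable (fun x : ℝ => h x) (cauchyMeasure γ.re σ) := by
    obtain ⟨K, -, hK⟩ := cauchyMeasure_moment γ.re hσ
    have := (hK (1 - s) (by linarith)).1
    rw [sub_sub_cancel] at this
    refine (this.const_mul C).mono' hcont.aestronglyMeasurable (ae_of_all _ fun x => ?_)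
    simpa using hb x (hreal x)
  set γ' : ℂ := (starRingEnd ℂ) γ with hγ'
  have hne' : ∀ z ∈ closedUpperHalfPlane, z - γ' ≠ 0 := by
    intro z hz h0
    have := congrArg Complex.im h0
    have hz' : 0 ≤ z.im := hz
    simp [hγ'] at this
    linarith
  have hnereal : ∀ x : ℝ, (x : ℂ) ≠ γ := by
    intro x h0
    have := congrArg Complex.im h0
    simp at this; linarith
  -- The density is (σ/π)/((x-γ)(x-γ̄)), so density times h(x) - h(γ) is a multiple of q on the real
  -- line. `dslope` removes the singularity at γ, and γ̄ lies outside the half-plane.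
  set q : ℂ → ℂ := fun z => dslope h γ z / (z - γ') with hq
  have hdiffγ : DifferentiableAt ℂ h γ := hd.differentiableAt (hopen.mem_nhds hγ)
  have hqc : ContinuousOn q closedUpperHalfPlane := by
    refine ContinuousOn.div ?_ (by fun_prop) hne'
    exact (continuousOn_dslope (mem_of_superset (hopen.mem_nhds hγ) hsub)).2 ⟨hc, hdiffγ⟩
  have hqd : DifferentiableOn ℂ q {z : ℂ | 0 < z.im} := by
    refine DifferentiableOn.div ?_ (by fun_prop) fun z hz => hne' z (hsub hz)
    exact (Complex.differentiableOn_dslope (hopen.mem_nhds hγ)).2 hd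
  have hqreal : ∀ x : ℝ, cauchyPDFReal γ.re σ x • (h x - h γ)
      = ((Real.pi⁻¹ * γ.im : ℝ) : ℂ) * q x := by
    intro x
    have hx1 := sub_ne_zero.2 (hnereal x)
    have hx2 := hne' x (hreal x)
    have hD : (x - γ) * (x - γ') = (((x - γ.re) ^ 2 + γ.im ^ 2 : ℝ) : ℂ) := by
      apply Complex.ext
      · rw [Complex.ofReal_re]; simp [hγ']; ring
      · rw [Complex.ofReal_im]; simp [hγ']; ring
    rw [hq]
    simp only
    rw [dslope_of_ne _ (hnereal x), slope_def_field, div_div, hD, cauchyPDFReal_def,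
      Complex.real_smul]
    rw [show (σ : ℝ) = γ.im from rfl]
    push_cast
    ring
  -- Beyond radius 2‖γ‖ both |z - γ| and |z - γ̄| are at least |z|/2; this is the source of the
  -- factor 4.
  have hqb : ∀ z ∈ closedUpperHalfPlane, max 1 (2 * ‖γ‖) ≤ ‖z‖ →
      ‖q z‖ ≤ (4 * (C * 2 ^ s + ‖h γ‖)) * ‖z‖ ^ (s - 2) := by
    intro z hz hR
    have hz1 : 1 ≤ ‖z‖ := (le_max_left _ _).trans hR
    have hz2 : 2 * ‖γ‖ ≤ ‖z‖ := (le_max_right _ _).trans hR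
    have hz0 : 0 < ‖z‖ := by linarith
    have hγ0 : 0 < ‖γ‖ := norm_pos_iff.2 fun h => by simp [h] at hγ
    have hzγ : z ≠ γ := by rintro rfl; linarith
    have e1 : ‖z‖ / 2 ≤ ‖z - γ‖ := by
      have := norm_sub_norm_le z γ; linarith
    have e2 : ‖z‖ / 2 ≤ ‖z - γ'‖ := by
      have := norm_sub_norm_le z γ'
      rw [hγ', Complex.norm_conj] at this; rw [hγ']; linarith
    have e3 : ‖h z - h γ‖ ≤ (C * 2 ^ s + ‖h γ‖) * ‖z‖ ^ s := by
      have h1 : (1 + ‖z‖) ^ s ≤ (2 * ‖z‖) ^ s := by gcongr; linarith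
      rw [Real.mul_rpow (by norm_num) hz0.le] at h1
      have h2 : 1 ≤ ‖z‖ ^ s := Real.one_le_rpow hz1 hs0
      calc ‖h z - h γ‖ ≤ C * (1 + ‖z‖) ^ s + ‖h γ‖ :=
            (norm_sub_le _ _).trans (by gcongr; exact hb z hz)
        _ ≤ C * (2 ^ s * ‖z‖ ^ s) + ‖h γ‖ * ‖z‖ ^ s := by
            gcongr
            exact le_mul_of_one_le_right (norm_nonneg _) h2
        _ = _ := by ring
    have hpow : ‖z‖ ^ (s - 2) = ‖z‖ ^ s / ‖z‖ ^ 2 := by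
      rw [Real.rpow_sub hz0, Real.rpow_two]
    rw [hq]
    simp only
    rw [dslope_of_ne _ hzγ, slope_def_field, div_div, norm_div, norm_mul]
    calc ‖h z - h γ‖ / (‖z - γ‖ * ‖z - γ'‖)
        ≤ ((C * 2 ^ s + ‖h γ‖) * ‖z‖ ^ s) / (‖z‖ / 2 * (‖z‖ / 2)) := by gcongr
      _ = _ := by rw [hpow]; field_simp; norm_num
  have hpi : (Real.pi⁻¹ * γ.im : ℝ) ≠ 0 := by positivity
  have hconst : Integrable (fun _ : ℝ => h γ) (cauchyMeasure γ.re σ) := integrable_const _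
  have hqi : Integrable fun x : ℝ => q x := by
    have := (integrable_cauchyMeasure_iff γ.re hσ).1 (hint.sub hconst)
    simp only [Pi.sub_apply, hqreal] at this
    have h2 := this.const_mul ((((Real.pi⁻¹ * γ.im : ℝ) : ℂ))⁻¹)
    refine h2.congr (ae_of_all _ fun x => ?_)
    simp only
    rw [inv_mul_cancel_left₀ (by exact_mod_cast hpi)]
  have hzero := integral_eq_zero_of_halfPlane hqc hqd hs hqb hqi
  have hfin : ∫ x : ℝ, (h x - h γ) ∂(cauchyMeasure γ.re σ) = 0 := by
    rw [integral_cauchyMeasure γ.re hσ]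
    simp only [hqreal]
    rw [integral_const_mul, hzero, mul_zero]
  rw [integral_sub hint hconst] at hfin
  simpa [sub_eq_zero] using hfin

/-! ### The defect as a function of one coordinate -/

/-- Each cross term involves two distinct indices, so the one large entry occurs at most once, to
the power q or 1 - q. -/
lemma crossMoment_le_of_le {q : ℝ} (hq : 0 ≤ q) (hq1 : q ≤ 1) {n : ℕ} {a : Fin n → ℝ}
    (ha : ∀ j, 0 ≤ a j) {L t s : ℝ} (hL : 0 < L) (ht : 1 ≤ t) (hs : q ≤ s) (hs' : 1 - q ≤ s)
    (i : Fin n) (hi : a i ≤ L * t) (hj : ∀ j, j ≠ i → a j ≤ L) :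
    crossMoment q a ≤ (n : ℝ) ^ 2 * L * t ^ s := by
  have ht0 : 0 ≤ t := by linarith
  have hts : 1 ≤ t ^ s := Real.one_le_rpow ht (by linarith)
  have hLL : L ^ (1 - q) * L ^ q = L := by rw [← Real.rpow_add hL]; simp
  have key : ∀ k l : Fin n, l ≠ k → a k ^ (1 - q) * a l ^ q ≤ L * t ^ s := by
    intro k l hlk
    have hk0 := ha k
    have hl0 := ha l
    have h1q : 0 ≤ 1 - q := by linarith
    by_cases hk : k = i
    · subst hk
      calc a k ^ (1 - q) * a l ^ q ≤ (L * t) ^ (1 - q) * L ^ q := by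
            gcongr; exact hj l hlk
        _ = (L ^ (1 - q) * L ^ q) * t ^ (1 - q) := by
            rw [Real.mul_rpow hL.le ht0]; ring
        _ ≤ L * t ^ s := by
            rw [hLL]; gcongr
    by_cases hl : l = i
    · subst hl
      calc a k ^ (1 - q) * a l ^ q ≤ L ^ (1 - q) * (L * t) ^ q := by
            gcongr; exact hj k hk
        _ = (L ^ (1 - q) * L ^ q) * t ^ q := by
            rw [Real.mul_rpow hL.le ht0]; ring
        _ ≤ L * t ^ s := by
            rw [hLL]; gcongr
    · calc a k ^ (1 - q) * a l ^ q ≤ L ^ (1 - q) * L ^ q := by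
            gcongr
            · exact hj k hk
            · exact hj l hl
        _ = L := hLL
        _ ≤ L * t ^ s := le_mul_of_one_le_right hL.le hts
  calc crossMoment q a ≤ ∑ _i : Fin n, ∑ _j : Fin n, L * t ^ s := by
        refine Finset.sum_le_sum fun k _ => ?_
        refine (Finset.sum_le_sum fun l hl => key k l (Finset.ne_of_mem_erase hl)).trans ?_
        refine Finset.sum_le_sum_of_subset_of_nonneg (Finset.erase_subset _ _) fun _ _ _ => ?_
        positivity
    _ = _ := by simp; ring

/-- On the negative axis the principal logarithm is continuous from above, which is the only side
seen here. -/
lemma continuousOn_cpow_closedUpperHalfPlane {p : ℝ} (hp : 0 < p) :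
    ContinuousOn (fun z : ℂ => z ^ (p : ℂ)) closedUpperHalfPlane := by
  intro z hz
  by_cases h : 0 ≤ z.re ∨ z.im ≠ 0
  · exact (Complex.continuousAt_cpow_const_of_re_pos h (by simpa using hp)).continuousWithinAt
  · push Not at h
    have hz0 : z ≠ 0 := by rintro rfl; simp at h
    have h1 := Complex.continuousWithinAt_log_of_re_neg_of_im_zero h.1 h.2
    have h2 : ContinuousWithinAt (fun w : ℂ => Complex.exp (Complex.log w * p))
        closedUpperHalfPlane z := (h1.mul_const _).cexp
    refine h2.congr_of_eventuallyEq ?_ (Complex.cpow_def_of_ne_zero hz0 _)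
    filter_upwards [mem_nhdsWithin_of_mem_nhds (isOpen_ne.mem_nhds hz0)] with w hw
    exact Complex.cpow_def_of_ne_zero hw _

lemma sum_update_cpow {n : ℕ} (v : Fin n → ℂ) (i : Fin n) (w : ℂ) (q : ℂ) :
    ∑ j, Function.update v i w j ^ q = w ^ q + ∑ j ∈ Finset.univ.erase i, v j ^ q := by
  rw [← Finset.add_sum_erase _ _ (Finset.mem_univ i), Function.update_self]
  congr 1
  exact Finset.sum_congr rfl fun j hj => by rw [Function.update_of_ne (Finset.ne_of_mem_erase hj)]

lemma powerDefect_update {n : ℕ} (p : ℝ) (v : Fin n → ℂ) (i : Fin n) (w : ℂ) :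
    powerDefect p (Function.update v i w)
      = (w ^ (p : ℂ) + ∑ j ∈ Finset.univ.erase i, v j ^ (p : ℂ)) ^ ((1 / p : ℝ) : ℂ)
        - (w + ∑ j ∈ Finset.univ.erase i, v j) := by
  have := sum_update_cpow v i w 1
  simp only [Complex.cpow_one] at this
  rw [powerDefect, sum_update_cpow, this]

lemma continuousOn_powerDefect_update {p : ℝ} (hp : 0 < p) (hp1 : p < 1) {n : ℕ}
    {v : Fin n → ℂ} (hv : ∀ j, 0 ≤ (v j).im) (i : Fin n) :
    ContinuousOn (fun w => powerDefect p (Function.update v i w)) closedUpperHalfPlane := by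
  simp only [powerDefect_update]
  refine ContinuousOn.sub ?_ (by fun_prop)
  have h1 := (continuousOn_cpow_closedUpperHalfPlane hp).add
    (continuousOn_const (c := ∑ j ∈ Finset.univ.erase i, v j ^ (p : ℂ)))
  intro w hw
  have hwim : 0 ≤ w.im := hw
  have hw' : ∀ j, 0 ≤ (Function.update v i w j).im := by
    intro j
    rcases eq_or_ne j i with rfl | h
    · simpa using hwim
    · simpa [h] using hv j
  have harg := (arg_sum_cpow_mem Finset.univ hp hp1 hw').2
  rw [sum_update_cpow] at harg
  have hpi := Real.pi_pos
  have hlt := Complex.arg_lt_pi_iff.1 (harg.trans_lt (by nlinarith))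
  exact ContinuousAt.comp_continuousWithinAt (g := fun u : ℂ => u ^ ((1 / p : ℝ) : ℂ))
    (Complex.continuousAt_cpow_const_of_re_pos hlt (by simpa using hp)) (h1 w hw)

/-- Holomorphy of the outer power needs the sum to be nonzero as well as off the cut. The term w^p
with w ≠ 0 puts it in `argCone`. -/
lemma differentiableOn_powerDefect_update {p : ℝ} (hp : 0 < p) (hp1 : p < 1) {n : ℕ}
    {v : Fin n → ℂ} (hv : ∀ j, 0 ≤ (v j).im) (i : Fin n) :
    DifferentiableOn ℂ (fun w => powerDefect p (Function.update v i w)) {z : ℂ | 0 < z.im} := by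
  simp only [powerDefect_update]
  intro w hw
  have hw' : 0 < w.im := hw
  have hw0 : w ≠ 0 := by rintro rfl; simp at hw'
  have hpi := Real.pi_pos
  have hr := arg_sum_cpow_mem (Finset.univ.erase i) hp hp1 hv
  have hS := argCone_subset_slitPlane
    (add_mem_argCone (cpow_mem_argCone hw'.le hw0 hp hp1) hr.1 (by nlinarith [hr.2]))
  have h1 : DifferentiableAt ℂ (fun w : ℂ => w ^ (p : ℂ)) w :=
    differentiableAt_id.cpow_const (Or.inr hw'.ne')
  exact (((h1.add_const _).cpow_const hS).sub (by fun_prop)).differentiableWithinAt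

lemma exists_norm_powerDefect_update_le {p : ℝ} (hp : 0 < p) (hp1 : p < 1) {n : ℕ} (hn : 2 ≤ n)
    {v : Fin n → ℂ} (hv : ∀ j, 0 ≤ (v j).im) (i : Fin n) {α : ℂ} (hα : 0 ≤ α.im) :
    ∃ C s : ℝ, 0 ≤ s ∧ s < 1 ∧ ∀ z ∈ closedUpperHalfPlane,
      ‖powerDefect p (Function.update v i (z + α))‖ ≤ C * (1 + ‖z‖) ^ s := by
  set L := 1 + ‖α‖ + ∑ j, ‖v j‖ with hLdef
  have hsum : 0 ≤ ∑ j, ‖v j‖ := Finset.sum_nonneg fun _ _ => norm_nonneg _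
  have hL : 0 < L := by positivity
  -- The exponent must dominate q and 1 - q for both q = p and q = 1/3, and stay below 1.
  set s := max (max p (1 - p)) (2 / 3) with hsdef
  have hs1 : p ≤ s := (le_max_left _ _).trans (le_max_left _ _)
  have hs2 : 1 - p ≤ s := (le_max_right _ _).trans (le_max_left _ _)
  have hs3 : 2 / 3 ≤ s := le_max_right _ _
  refine ⟨2 / p * (((n : ℝ) + 1) / 2) ^ (1 / p) * ((n : ℝ) ^ 2 * L)
    + ((n : ℝ) + 1) * (n : ℝ) ^ (1 / p) * ((n : ℝ) ^ 2 * L), s, by linarith,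
    max_lt (max_lt hp1 (by linarith)) (by norm_num), fun z hz => ?_⟩
  have hz' : 0 ≤ z.im := hz
  have hw : ∀ j, 0 ≤ (Function.update v i (z + α) j).im := by
    intro j
    rcases eq_or_ne j i with rfl | h
    · simpa using add_nonneg hz' hα
    · simpa [h] using hv j
  have ht : 1 ≤ 1 + ‖z‖ := by linarith [norm_nonneg z]
  have hi : ‖Function.update v i (z + α) i‖ ≤ L * (1 + ‖z‖) := by
    rw [Function.update_self]
    have h1 := norm_add_le z α
    have h2 := norm_nonneg z
    have h3 := norm_nonneg α
    have h4 : 0 ≤ (‖α‖ + ∑ j, ‖v j‖) * ‖z‖ := by positivity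
    rw [hLdef]; linarith
  have hj : ∀ j, j ≠ i → ‖Function.update v i (z + α) j‖ ≤ L := by
    intro j h
    rw [Function.update_of_ne h]
    have := Finset.single_le_sum (f := fun j => ‖v j‖) (fun _ _ => norm_nonneg _)
      (Finset.mem_univ j)
    have h3 := norm_nonneg α
    rw [hLdef]; linarith
  have hQ : ∀ q : ℝ, 0 ≤ q → q ≤ 1 → q ≤ s → 1 - q ≤ s →
      crossMoment q (fun j => ‖Function.update v i (z + α) j‖)
        ≤ (n : ℝ) ^ 2 * L * (1 + ‖z‖) ^ s := fun q hq0 hq1 h1 h2 =>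
    crossMoment_le_of_le hq0 hq1 (fun _ => norm_nonneg _) hL ht h1 h2 i hi hj
  calc _ ≤ _ := norm_powerDefect_le hp hp1 hn hw
    _ ≤ 2 / p * (((n : ℝ) + 1) / 2) ^ (1 / p) * ((n : ℝ) ^ 2 * L * (1 + ‖z‖) ^ s)
        + ((n : ℝ) + 1) * (n : ℝ) ^ (1 / p) * ((n : ℝ) ^ 2 * L * (1 + ‖z‖) ^ s) := by
        gcongr
        · exact hQ p hp.le hp1.le hs1 hs2
        · exact hQ (1 / 3) (by norm_num) (by norm_num) (by linarith) (by linarith)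
    _ = _ := by ring

lemma measurable_powerDefect (p : ℝ) {n : ℕ} :
    Measurable (powerDefect p : (Fin n → ℂ) → ℂ) := by
  unfold powerDefect
  fun_prop

/-! ### Integration over independent Cauchy variables -/

/-- Resampling one coordinate preserves a product measure. -/
lemma measurePreserving_update_pi {ι : Type*} [Fintype ι] [DecidableEq ι] {E : Type*}
    [MeasurableSpace E] (ν : Measure E) [IsProbabilityMeasure ν] (i : ι) :
    MeasurePreserving (fun q : (ι → E) × E => Function.update q.1 i q.2)
      ((Measure.pi fun _ : ι => ν).prod ν) (Measure.pi fun _ : ι => ν) := by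
  have hm : Measurable (fun q : (ι → E) × E => Function.update q.1 i q.2) := by
    rw [measurable_pi_iff]
    intro j
    rcases eq_or_ne j i with rfl | h
    · simpa using measurable_snd
    · simp only [Function.update_of_ne h]
      exact (measurable_pi_apply j).comp measurable_fst
  refine ⟨hm, (Measure.pi_eq fun S hS => ?_).symm⟩
  rw [Measure.map_apply hm (MeasurableSet.univ_pi hS)]
  have hpre : (fun q : (ι → E) × E => Function.update q.1 i q.2) ⁻¹' Set.univ.pi S
      = (Set.univ.pi (Function.update S i Set.univ)) ×ˢ S i := by
    ext ⟨ω, x⟩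
    simp only [Set.mem_preimage, Set.mem_univ_pi, Set.mem_prod]
    constructor
    · intro h
      refine ⟨fun j => ?_, by simpa using h i⟩
      rcases eq_or_ne j i with rfl | hj
      · simp
      · simpa [hj] using h j
    · rintro ⟨h, hx⟩ j
      rcases eq_or_ne j i with rfl | hj
      · simpa using hx
      · simpa [hj] using h j
  rw [hpre, Measure.prod_prod, Measure.pi_pi, ← Finset.mul_prod_erase _ _ (Finset.mem_univ i),
    ← Finset.mul_prod_erase _ (fun j => ν (S j)) (Finset.mem_univ i)]
  simp only [Function.update_self, measure_univ, one_mul]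
  rw [mul_comm]
  congr 1
  exact Finset.prod_congr rfl fun j hj => by
    rw [Function.update_of_ne (Finset.ne_of_mem_erase hj)]

lemma integrable_mul_pi {n : ℕ} {ν : Measure ℝ} [IsProbabilityMeasure ν] {f g : ℝ → ℝ}
    (hf : Integrable f ν) (hg : Integrable g ν) {i j : Fin n} (hij : i ≠ j) :
    Integrable (fun ω : Fin n → ℝ => f (ω i) * g (ω j)) (Measure.pi fun _ => ν) ∧
      ∫ ω : Fin n → ℝ, f (ω i) * g (ω j) ∂(Measure.pi fun _ => ν)
        = (∫ x, f x ∂ν) * ∫ x, g x ∂ν := by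
  have hmp := fun k : Fin n => measurePreserving_eval (fun _ : Fin n => ν) k
  have hF : ∀ {f : ℝ → ℝ}, Integrable f ν → ∀ k : Fin n,
      Integrable (fun ω : Fin n → ℝ => f (ω k)) (Measure.pi fun _ => ν) := fun hf k =>
    (hmp k).integrable_comp_of_integrable hf
  have hE : ∀ {f : ℝ → ℝ}, Integrable f ν → ∀ k : Fin n,
      ∫ ω : Fin n → ℝ, f (ω k) ∂(Measure.pi fun _ => ν) = ∫ x, f x ∂ν := fun hf k => by
    have := (hmp k).hasLaw.integral_comp hf.aestronglyMeasurable
    simpa using this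
  have hind : IndepFun (fun ω : Fin n → ℝ => f (ω i)) (fun ω => g (ω j))
      (Measure.pi fun _ => ν) := by
    have h := (iIndepFun_pi (μ := fun _ : Fin n => ν) (X := fun _ x => x)
      fun _ => aemeasurable_id).indepFun hij
    refine h.comp₀ (φ := f) (ψ := g) (measurable_pi_apply i).aemeasurable
      (measurable_pi_apply j).aemeasurable ?_ ?_
    · rw [show (fun ω : Fin n → ℝ => ω i) = Function.eval i from rfl, (hmp i).map_eq]
      exact hf.aestronglyMeasurable.aemeasurable
    · rw [show (fun ω : Fin n → ℝ => ω j) = Function.eval j from rfl, (hmp j).map_eq]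
      exact hg.aestronglyMeasurable.aemeasurable
  refine ⟨hind.integrable_mul (hF hf i) (hF hg j), ?_⟩
  rw [hind.integral_fun_mul_eq_mul_integral (hF hf i).aestronglyMeasurable
    (hF hg j).aestronglyMeasurable, hE hf, hE hg]

/-- Integrability of cross moments under independent Cauchy variables, with a bound. -/
lemma integrable_crossMoment_pi (x₀ : ℝ) {σ : NNReal} (hσ : σ ≠ 0) :
    ∃ K : ℝ, 0 < K ∧ ∀ (n : ℕ) (D : ℝ) (v : Fin n → ℝ → ℂ) (p : ℝ), 0 < D →
      (∀ j, Measurable (v j)) → (∀ j x, ‖v j x‖ ≤ D * (1 + |x|)) → 0 < p → p < 1 →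
      Integrable (fun ω : Fin n → ℝ => crossMoment p (fun j => ‖v j (ω j)‖))
        (Measure.pi fun _ => cauchyMeasure x₀ σ) ∧
      ∫ ω : Fin n → ℝ, crossMoment p (fun j => ‖v j (ω j)‖)
        ∂(Measure.pi fun _ => cauchyMeasure x₀ σ) ≤ (n : ℝ) ^ 2 * (D * (K / p * (K / (1 - p)))) := by
  obtain ⟨K, hK, hmom⟩ := cauchyMeasure_moment x₀ hσ
  refine ⟨K, hK, fun n D v p hD hvm hv hp hp1 => ?_⟩
  set ν := cauchyMeasure x₀ σ
  have hmom' : ∀ (j : Fin n) (q : ℝ), 0 < q → q < 1 →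
      Integrable (fun x => ‖v j x‖ ^ (1 - q)) ν ∧
        ∫ x, ‖v j x‖ ^ (1 - q) ∂ν ≤ D ^ (1 - q) * (K / q) := by
    intro j q hq hq1
    obtain ⟨h1, h2⟩ := hmom q hq
    have hle : ∀ x, ‖v j x‖ ^ (1 - q) ≤ D ^ (1 - q) * (1 + |x|) ^ (1 - q) := by
      intro x
      rw [← Real.mul_rpow hD.le (by positivity)]
      have : 0 ≤ 1 - q := by linarith
      gcongr
      exact hv j x
    have hi : Integrable (fun x => ‖v j x‖ ^ (1 - q)) ν := by
      refine (h1.const_mul (D ^ (1 - q))).mono' ?_ (ae_of_all _ fun x => ?_)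
      · exact ((hvm j).norm.pow_const _).aestronglyMeasurable
      · rw [Real.norm_of_nonneg (by positivity)]; exact hle x
    refine ⟨hi, (integral_mono hi (h1.const_mul _) hle).trans ?_⟩
    rw [integral_const_mul]
    gcongr
  have hterm : ∀ i j : Fin n, j ≠ i →
      Integrable (fun ω : Fin n → ℝ => ‖v i (ω i)‖ ^ (1 - p) * ‖v j (ω j)‖ ^ p)
        (Measure.pi fun _ => ν) ∧
      ∫ ω : Fin n → ℝ, ‖v i (ω i)‖ ^ (1 - p) * ‖v j (ω j)‖ ^ p ∂(Measure.pi fun _ => ν)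
        ≤ D * (K / p * (K / (1 - p))) := by
    intro i j hji
    -- Independence separates the factors into moments of orders 1 - p and p, both below 1. They
    -- contribute K/p and K/(1-p).
    obtain ⟨h1, h2⟩ := hmom' i p hp hp1
    obtain ⟨h3, h4⟩ := hmom' j (1 - p) (by linarith) (by linarith)
    rw [sub_sub_cancel] at h4
    simp only [sub_sub_cancel] at h3 h4
    obtain ⟨h5, h6⟩ := integrable_mul_pi h1 h3 hji.symm
    refine ⟨h5, h6.le.trans ?_⟩
    have hDD : D ^ (1 - p) * D ^ p = D := by rw [← Real.rpow_add hD]; simp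
    have h1p : 0 < 1 - p := by linarith
    calc _ ≤ (D ^ (1 - p) * (K / p)) * (D ^ p * (K / (1 - p))) := by
          gcongr
      _ = (D ^ (1 - p) * D ^ p) * (K / p * (K / (1 - p))) := by ring
      _ = _ := by rw [hDD]
  have hi1 : ∀ i : Fin n, Integrable (fun ω : Fin n → ℝ =>
      ∑ j ∈ Finset.univ.erase i, ‖v i (ω i)‖ ^ (1 - p) * ‖v j (ω j)‖ ^ p)
        (Measure.pi fun _ => ν) := fun i =>
    integrable_finsetSum _ fun j hj => (hterm i j (Finset.ne_of_mem_erase hj)).1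
  have h1p : 0 < 1 - p := by linarith
  refine ⟨integrable_finsetSum _ fun i _ => hi1 i, ?_⟩
  simp only [crossMoment]
  rw [integral_finsetSum _ fun i _ => hi1 i]
  calc _ ≤ ∑ _i : Fin n, ∑ _j : Fin n, D * (K / p * (K / (1 - p))) := by
        refine Finset.sum_le_sum fun i _ => ?_
        rw [integral_finsetSum _ fun j hj => (hterm i j (Finset.ne_of_mem_erase hj)).1]
        refine (Finset.sum_le_sum fun j hj => (hterm i j (Finset.ne_of_mem_erase hj)).2).trans ?_
        refine Finset.sum_le_sum_of_subset_of_nonneg (Finset.erase_subset _ _) fun _ _ _ => ?_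
        positivity
    _ = _ := by simp; ring

lemma integrable_powerDefect_pi (x₀ : ℝ) {σ : NNReal} (hσ : σ ≠ 0) {p : ℝ} (hp : 0 < p)
    (hp1 : p < 1) {n : ℕ} (hn : 2 ≤ n) {v : Fin n → ℝ → ℂ} (hvm : ∀ j, Measurable (v j)) {D : ℝ}
    (hD : 0 < D) (hv : ∀ j x, ‖v j x‖ ≤ D * (1 + |x|)) (him : ∀ j x, 0 ≤ (v j x).im) :
    Integrable (fun ω : Fin n → ℝ => powerDefect p (fun j => v j (ω j)))
      (Measure.pi fun _ => cauchyMeasure x₀ σ) := by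
  obtain ⟨K, -, hK⟩ := integrable_crossMoment_pi x₀ hσ
  have h1 := (hK n D v p hD hvm hv hp hp1).1
  have h2 := (hK n D v (1 / 3) hD hvm hv (by norm_num) (by norm_num)).1
  refine ((h1.const_mul _).add (h2.const_mul _)).mono' ?_
    (ae_of_all _ fun ω => norm_powerDefect_le hp hp1 hn fun j => him j (ω j))
  refine ((measurable_powerDefect p).comp ?_).aestronglyMeasurable
  exact measurable_pi_iff.2 fun j => (hvm j).comp (measurable_pi_apply j)

/-- The mean value property of `powerDefect` under independent Cauchy variables. -/
lemma integral_powerDefect_pi {γ : ℂ} (hγ : 0 < γ.im) {p : ℝ} (hp : 0 < p) (hp1 : p < 1) {n : ℕ}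
    (hn : 2 ≤ n) {α : ℂ} (hα : 0 ≤ α.im) :
    ∫ ω : Fin n → ℝ, powerDefect p (fun j => (ω j : ℂ) + α)
      ∂(Measure.pi fun _ => cauchyMeasure γ.re ⟨γ.im, hγ.le⟩)
      = powerDefect p (fun _ : Fin n => γ + α) := by
  set σ : NNReal := ⟨γ.im, hγ.le⟩ with hσdef
  have hσ : σ ≠ 0 := by
    intro h; have := congrArg NNReal.toReal h; simp [hσdef] at this; exact hγ.ne' this
  set ν := cauchyMeasure γ.re σ
  -- Coordinates in s are random and the others are frozen at γ + α. Induction on s unfreezes one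
  -- coordinate at a time.
  let V : Finset (Fin n) → Fin n → ℝ → ℂ := fun s j x => if j ∈ s then (x : ℂ) + α else γ + α
  have hVm : ∀ s j, Measurable (V s j) := by
    intro s j
    by_cases h : j ∈ s
    · simp only [V, h, if_true]; fun_prop
    · simp only [V, h, if_false]; fun_prop
  have hVim : ∀ s j x, 0 ≤ (V s j x).im := by
    intro s j x
    by_cases h : j ∈ s
    · simp [V, h, hα]
    · simp [V, h]; linarith
  have hVn : ∀ s j x, ‖V s j x‖ ≤ (1 + ‖α‖ + ‖γ‖) * (1 + |x|) := by
    intro s j x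
    have hx := abs_nonneg x
    have ha := norm_nonneg α
    have hg := norm_nonneg γ
    by_cases h : j ∈ s
    · simp only [V, h, if_true]
      have := norm_add_le (x : ℂ) α
      rw [Complex.norm_real, Real.norm_eq_abs] at this
      nlinarith [mul_nonneg ha hx, mul_nonneg hg hx]
    · simp only [V, h, if_false]
      have := norm_add_le γ α
      nlinarith [mul_nonneg ha hx, mul_nonneg hg hx]
  have hint := fun s => integrable_powerDefect_pi γ.re hσ hp hp1 hn (hVm s)
    (by positivity) (hVn s) (hVim s)
  have hmain : ∀ s : Finset (Fin n),
      ∫ ω : Fin n → ℝ, powerDefect p (fun j => V s j (ω j)) ∂(Measure.pi fun _ => ν)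
        = powerDefect p (fun _ : Fin n => γ + α) := by
    intro s
    induction s using Finset.induction_on with
    | empty => simp [V]
    | insert i s his ih =>
      have hmp := measurePreserving_update_pi ν i
      have hupd : ∀ (ω : Fin n → ℝ) (x : ℝ),
          (fun j => V (insert i s) j (Function.update ω i x j))
            = Function.update (fun j => V s j (ω j)) i ((x : ℂ) + α) := by
        intro ω x
        ext j
        rcases eq_or_ne j i with rfl | h
        · simp [V]
        · simp [V, h]
      have hupd' : ∀ ω : Fin n → ℝ,
          Function.update (fun j => V s j (ω j)) i (γ + α) = fun j => V s j (ω j) := by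
        intro ω
        refine Function.update_eq_self_iff.2 ?_
        simp [V, his]
      have hint' := hmp.integrable_comp_of_integrable (hint (insert i s))
      simp only [Function.comp_def] at hint'
      -- Resampling coordinate i turns the integral into an iterated one. The mean value property
      -- evaluates the inner integral at γ, which is the already frozen value for s.
      rw [← hmp.map_eq, integral_map hmp.measurable.aemeasurable
        (by rw [hmp.map_eq]; exact (hint _).aestronglyMeasurable)]
      rw [integral_prod _ hint', ← ih]
      apply integral_congr_ae
      filter_upwards with ω
      simp only [hupd]
      have hvω : ∀ j, 0 ≤ (V s j (ω j)).im := fun j => hVim s j (ω j)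
      obtain ⟨C, r, hr0, hr1, hC⟩ := exists_norm_powerDefect_update_le hp hp1 hn hvω i hα
      have hshift : Set.MapsTo (fun z : ℂ => z + α) closedUpperHalfPlane closedUpperHalfPlane :=
        fun z (hz : 0 ≤ z.im) => show 0 ≤ (z + α).im by simpa using add_nonneg hz hα
      have hshift' : Set.MapsTo (fun z : ℂ => z + α) {z : ℂ | 0 < z.im} {z : ℂ | 0 < z.im} :=
        fun z (hz : 0 < z.im) => show 0 < (z + α).im by simpa using add_pos_of_pos_of_nonneg hz hα
      have := integral_cauchyMeasure_eq_of_holomorphic hγ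
        (h := fun z => powerDefect p (Function.update (fun j => V s j (ω j)) i (z + α)))
        ((continuousOn_powerDefect_update hp hp1 hvω i).comp (by fun_prop) hshift)
        ((differentiableOn_powerDefect_update hp hp1 hvω i).comp (by fun_prop) hshift')
        hr0 hr1 hC
      rw [this, hupd']
  have := hmain Finset.univ
  simpa [V] using this

lemma powerDefect_const {p : ℝ} (hp : 0 < p) (hp1 : p < 1) {n : ℕ} (hn : n ≠ 0) {z : ℂ}
    (hz : 0 ≤ z.im) :
    powerDefect p (fun _ : Fin n => z) = ((((n : ℝ) ^ (1 / p) : ℝ) : ℂ) - n) * z := by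
  have hn' : (0 : ℝ) < n := by positivity
  have := Complex.mul_cpow_of_pos hn' (z ^ (p : ℂ)) (1 / p) (by positivity)
  rw [cpow_cpow_inv_of_im_nonneg hz hp hp1.le, Complex.ofReal_natCast] at this
  simp only [powerDefect, Finset.sum_const, Finset.card_univ, Fintype.card_fin, nsmul_eq_mul, this]
  ring

/-! ### Pointwise limit as the exponent tends to zero -/

lemma tendsto_one_div_nhdsGT_zero : Tendsto (fun p : ℝ => 1 / p) (𝓝[>] 0) atTop := by
  simpa using tendsto_inv_nhdsGT_zero (𝕜 := ℝ)

lemma tendsto_rpow_one_div_atTop {b : ℝ} (hb : 1 < b) :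
    Tendsto (fun p : ℝ => b ^ (1 / p)) (𝓝[>] 0) atTop :=
  (tendsto_rpow_atTop_of_base_gt_one b hb).comp tendsto_one_div_nhdsGT_zero

/-- Power means converge to the geometric mean as the exponent tends to zero. -/
lemma tendsto_powerMean {n : ℕ} (hn : n ≠ 0) {z : Fin n → ℂ} (hz : ∀ j, z j ≠ 0) :
    Tendsto (fun p : ℝ => ((∑ j, z j ^ (p : ℂ)) / n) ^ ((1 / p : ℝ) : ℂ)) (𝓝[>] 0)
      (𝓝 (∏ j, z j ^ (1 / (n : ℂ)))) := by
  have hn' : (n : ℂ) ≠ 0 := by exact_mod_cast hn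
  set W : ℝ → ℂ := fun p => (∑ j, z j ^ (p : ℂ)) / n with hW
  have hW0 : W 0 = 1 := by simp [hW, hn']
  have hWd : HasDerivAt W ((∑ j, Complex.log (z j)) / n) 0 := by
    refine HasDerivAt.div_const (HasDerivAt.fun_sum fun j _ => ?_) _
    have h1 : HasDerivAt (fun p : ℝ => Complex.exp (Complex.log (z j) * (p : ℂ)))
        (Complex.exp (Complex.log (z j) * ((0 : ℝ) : ℂ)) * (Complex.log (z j) * 1)) 0 :=
      ((Complex.ofRealCLM.hasDerivAt (x := (0 : ℝ))).const_mul (Complex.log (z j))).cexp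
    simp only [Complex.ofReal_zero, mul_zero, Complex.exp_zero, one_mul, mul_one] at h1
    refine h1.congr_of_eventuallyEq (Eventually.of_forall fun p => ?_)
    simp [Complex.cpow_def_of_ne_zero (hz j)]
  -- W(0) = 1, so (1/p) log W(p) is a difference quotient at 0. Its limit is the mean of the
  -- logarithms.
  have hlogd : HasDerivAt (fun p => Complex.log (W p)) ((∑ j, Complex.log (z j)) / n) 0 := by
    have := hWd.clog_real (by rw [hW0]; simp)
    simpa [hW0] using this
  have hslope := (hasDerivAt_iff_tendsto_slope_zero.1 hlogd).mono_left
    (nhdsWithin_mono (0 : ℝ) (show Set.Ioi (0 : ℝ) ⊆ {0}ᶜ from fun p hp => ne_of_gt hp))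
  simp only [zero_add, hW0, Complex.log_one, sub_zero] at hslope
  have hG : ∏ j, z j ^ (1 / (n : ℂ)) = Complex.exp ((∑ j, Complex.log (z j)) / n) := by
    rw [Finset.sum_div, Complex.exp_sum]
    refine Finset.prod_congr rfl fun j _ => ?_
    rw [Complex.cpow_def_of_ne_zero (hz j)]
    ring_nf
  rw [hG]
  refine ((Complex.continuous_exp.tendsto _).comp hslope).congr' ?_
  have hne : ∀ᶠ p in 𝓝[>] (0 : ℝ), W p ≠ 0 :=
    nhdsWithin_le_nhds (hWd.continuousAt.eventually_ne (by rw [hW0]; exact one_ne_zero))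
  filter_upwards [hne] with p hp
  rw [Function.comp_apply, Complex.cpow_def_of_ne_zero hp, Complex.real_smul]
  push_cast
  ring_nf

lemma truncatedPowerMean_eq {α : ℂ} (hα : 0 ≤ α.im) {p : ℝ} (hp : 0 < p) (hp1 : p < 1)
    {n : ℕ} (hn : 2 ≤ n) (x : Fin n → ℝ) :
    truncatedPowerMean α p x = powerDefect p (fun j => (x j : ℂ) + α)
      / ((((n : ℝ) ^ (1 / p) : ℝ) : ℂ) - n) - α := by
  have hlt : (n : ℝ) < (n : ℝ) ^ (1 / p) := by
    have h1 : (1 : ℝ) < n := by exact_mod_cast hn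
    have h2 : 1 < 1 / p := by rw [lt_div_iff₀ hp]; linarith
    simpa using Real.rpow_lt_rpow_of_exponent_lt h1 h2
  have hne : ((((n : ℝ) ^ (1 / p) : ℝ) : ℂ) - n) ≠ 0 := by
    rw [sub_ne_zero]; intro h
    have : (n : ℝ) ^ (1 / p) = n := by exact_mod_cast h
    linarith
  rw [truncatedPowerMean, truncatedPowerSum_eq hα hp hp1 (by omega), sub_div,
    mul_div_cancel_left₀ _ hne]

lemma tendsto_truncatedPowerMean {α : ℂ} (hα : 0 ≤ α.im) {n : ℕ} (hn : 2 ≤ n) {x : Fin n → ℝ}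
    (hx : ∀ j, (x j : ℂ) + α ≠ 0) :
    Tendsto (fun p : ℝ => truncatedPowerMean α p x) (𝓝[>] 0) (𝓝 (geometricMean α x)) := by
  have hn0 : n ≠ 0 := by omega
  have hn' : (0 : ℝ) < n := by positivity
  have hn1 : (1 : ℝ) < n := by exact_mod_cast hn
  have hM := tendsto_powerMean hn0 hx
  have hN := tendsto_rpow_one_div_atTop hn1
  have hinv : Tendsto (fun p : ℝ => ((((n : ℝ) ^ (1 / p) - n)⁻¹ : ℝ) : ℂ)) (𝓝[>] 0) (𝓝 0) := by
    have := tendsto_inv_atTop_zero.comp (tendsto_atTop_add_const_right _ (-(n : ℝ)) hN)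
    simpa [Function.comp_def, sub_eq_add_neg] using
      (Complex.continuous_ofReal.tendsto 0).comp this
  set z : Fin n → ℂ := fun j => (x j : ℂ) + α with hz
  -- With M the power mean and N = n^{1/p}, (N M - ∑ zⱼ)/(N - n) = M + (n M - ∑ zⱼ)/(N - n), and the
  -- last term vanishes.
  have hlim : Tendsto (fun p : ℝ => ((∑ j, z j ^ (p : ℂ)) / n) ^ ((1 / p : ℝ) : ℂ)
      + ((((n : ℝ) ^ (1 / p) - n)⁻¹ : ℝ) : ℂ)
        * (n * ((∑ j, z j ^ (p : ℂ)) / n) ^ ((1 / p : ℝ) : ℂ) - ∑ j, z j) - α) (𝓝[>] 0)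
      (𝓝 (∏ j, z j ^ (1 / (n : ℂ)) + 0 * (n * ∏ j, z j ^ (1 / (n : ℂ)) - ∑ j, z j) - α)) :=
    (hM.add (hinv.mul ((hM.const_mul _).sub_const _))).sub_const _
  rw [zero_mul, add_zero] at hlim
  refine hlim.congr' ?_
  have hmem : ∀ᶠ p : ℝ in 𝓝[>] 0, p < 1 := nhdsWithin_le_nhds (eventually_lt_nhds one_pos)
  filter_upwards [hmem, self_mem_nhdsWithin, hN.eventually_gt_atTop (n : ℝ)] with p hp1 hp hgt
  have hp : 0 < p := hp
  rw [truncatedPowerMean_eq hα hp hp1 hn]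
  have h1 := Complex.mul_cpow_of_pos hn' ((∑ j, z j ^ (p : ℂ)) / n) (1 / p) (by positivity)
  rw [Complex.ofReal_natCast, mul_div_cancel₀ _ (by exact_mod_cast hn0)] at h1
  rw [powerDefect, h1]
  have hne : (((((n : ℝ) ^ (1 / p) : ℝ) : ℂ)) - n) ≠ 0 := by
    rw [sub_ne_zero]; intro h
    have : (n : ℝ) ^ (1 / p) = n := by exact_mod_cast h
    linarith
  rw [Complex.ofReal_inv, Complex.ofReal_sub, Complex.ofReal_natCast]
  field_simp
  ring

/-! ### Convergence in L¹ -/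

/-- `L¹` convergence to zero under domination by a fixed integrable function plus a family
tending to zero in `L¹`. -/
lemma tendsto_eLpNorm_one_of_dominated_add {Ω ι E : Type*} [MeasurableSpace Ω]
    [NormedAddCommGroup E] {μ : Measure Ω} {l : Filter ι} [l.IsCountablyGenerated]
    {f : ι → Ω → E} {g : ι → Ω → ℝ} {h : Ω → ℝ}
    (hf : ∀ᶠ i in l, AEStronglyMeasurable (f i) μ) (hg : ∀ᶠ i in l, Integrable (g i) μ)
    (hg0 : ∀ᶠ i in l, 0 ≤ᵐ[μ] g i) (hh : Integrable h μ) (hh0 : 0 ≤ᵐ[μ] h)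
    (hbd : ∀ᶠ i in l, ∀ᵐ ω ∂μ, ‖f i ω‖ ≤ g i ω + h ω)
    (hglim : Tendsto (fun i => ∫ ω, g i ω ∂μ) l (𝓝 0))
    (hflim : ∀ᵐ ω ∂μ, Tendsto (fun i => f i ω) l (𝓝 0)) :
    Tendsto (fun i => eLpNorm (f i) 1 μ) l (𝓝 0) := by
  -- Dominated convergence applies to min(‖f‖, h), and ‖f‖ ≤ g + min(‖f‖, h) recovers f.
  have hmin : Tendsto (fun i => ∫ ω, min ‖f i ω‖ (h ω) ∂μ) l (𝓝 0) := by
    have := tendsto_integral_filter_of_dominated_convergence (μ := μ) (l := l)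
      (F := fun i ω => min ‖f i ω‖ (h ω)) (f := fun _ => (0 : ℝ)) h ?_ ?_ hh ?_
    · simpa using this
    · filter_upwards [hf] with i hi using hi.norm.inf hh.aestronglyMeasurable
    · filter_upwards with i
      filter_upwards [hh0] with ω hω
      have hω : 0 ≤ h ω := hω
      rw [Real.norm_of_nonneg (le_min (norm_nonneg _) hω)]
      exact min_le_right _ _
    · filter_upwards [hflim, hh0] with ω hω hω0
      have hω0 : 0 ≤ h ω := hω0
      have := hω.norm.min (tendsto_const_nhds (x := h ω))
      simpa [hω0] using this
  have hsum := ENNReal.tendsto_ofReal (hglim.add hmin)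
  rw [add_zero, ENNReal.ofReal_zero] at hsum
  refine tendsto_of_tendsto_of_tendsto_of_le_of_le' tendsto_const_nhds hsum
    (Eventually.of_forall fun _ => zero_le) ?_
  filter_upwards [hf, hg, hg0, hbd] with i hfi hgi hgi0 hbi
  have hmi : Integrable (fun ω => min ‖f i ω‖ (h ω)) μ := by
    refine hh.mono' (hfi.norm.inf hh.aestronglyMeasurable) ?_
    filter_upwards [hh0] with ω hω
    have hω : 0 ≤ h ω := hω
    rw [Real.norm_of_nonneg (le_min (norm_nonneg _) hω)]
    exact min_le_right _ _
  have hfint : Integrable (f i) μ := (hgi.add hh).mono' hfi hbi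
  rw [eLpNorm_one_eq_lintegral_enorm, ← ofReal_integral_norm_eq_lintegral_enorm hfint,
    ← integral_add hgi hmi]
  refine ENNReal.ofReal_le_ofReal (integral_mono_ae hfint.norm (hgi.add hmi) ?_)
  filter_upwards [hbi, hgi0] with ω h1 h2
  have h2 : 0 ≤ g i ω := h2
  rcases le_total ‖f i ω‖ (h ω) with h3 | h3
  · rw [min_eq_left h3]; linarith
  · rw [min_eq_right h3]; exact h1

lemma tendsto_sq_mul_rpow_one_div {ρ : ℝ} (hρ : 0 < ρ) (hρ1 : ρ < 1) :
    Tendsto (fun p : ℝ => (1 / p) ^ 2 * ρ ^ (1 / p)) (𝓝[>] 0) (𝓝 0) := by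
  have h := tendsto_rpow_mul_exp_neg_mul_atTop_nhds_zero 2 (-Real.log ρ)
    (by simpa using Real.log_neg hρ hρ1)
  refine (h.comp tendsto_one_div_nhdsGT_zero).congr fun p => ?_
  simp only [Function.comp_apply, neg_neg, Real.rpow_two]
  rw [Real.rpow_def_of_pos hρ]

/-- For p ≤ 1/2 and n ≥ 2, n^{1/p} ≥ n² ≥ 2n, so the denominator is at least n^{1/p}/2. Dividing
turns the dominant constant into a power of (n+1)/(2n) < 1 and makes the other one independent of p.
-/
lemma norm_truncatedPowerMean_sub_le {α : ℂ} (hα : 0 ≤ α.im) {p : ℝ} (hp : 0 < p)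
    (hp1 : p ≤ 1 / 2) {n : ℕ} (hn : 2 ≤ n) (x : Fin n → ℝ) :
    ‖truncatedPowerMean α p x - geometricMean α x‖
      ≤ 4 * (1 / p * (((n : ℝ) + 1) / (2 * n)) ^ (1 / p))
          * crossMoment p (fun j => ‖(x j : ℂ) + α‖)
        + (2 * ((n : ℝ) + 1) * crossMoment (1 / 3) (fun j => ‖(x j : ℂ) + α‖)
          + ∏ j, ‖(x j : ℂ) + α‖ ^ (1 / (n : ℝ))) := by
  have hn2 : (2 : ℝ) ≤ n := by exact_mod_cast hn
  have hn0 : (0 : ℝ) < n := by linarith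
  have hsq : (n : ℝ) ^ 2 ≤ (n : ℝ) ^ (1 / p) := by
    rw [← Real.rpow_two]
    refine Real.rpow_le_rpow_of_exponent_le (by linarith) ?_
    rw [le_div_iff₀ hp]; linarith
  set N := (n : ℝ) ^ (1 / p) with hN
  have hN0 : 0 < N := by positivity
  have hNn : N / 2 ≤ N - n := by nlinarith
  have hden : ‖((N : ℝ) : ℂ) - n‖ = N - n := by
    rw [← Complex.ofReal_natCast, ← Complex.ofReal_sub, Complex.norm_real, Real.norm_of_nonneg]
    linarith
  have hprod : ‖∏ j, ((x j : ℂ) + α) ^ (1 / (n : ℂ))‖ = ∏ j, ‖(x j : ℂ) + α‖ ^ (1 / (n : ℝ)) := by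
    rw [norm_prod]
    refine Finset.prod_congr rfl fun j _ => ?_
    rw [← Complex.norm_cpow_real]
    push_cast
    rfl
  have hT := norm_powerDefect_le hp (by linarith) hn (z := fun j => (x j : ℂ) + α)
    fun j => by simpa using hα
  rw [truncatedPowerMean_eq hα hp (by linarith) hn, geometricMean, sub_sub_sub_cancel_right]
  refine (norm_sub_le _ _).trans ?_
  rw [hprod, norm_div, hden, ← add_assoc]
  gcongr
  set T := ‖powerDefect p fun j => (x j : ℂ) + α‖
  set Q := crossMoment p (fun j => ‖(x j : ℂ) + α‖)
  set Q' := crossMoment (1 / 3) (fun j => ‖(x j : ℂ) + α‖)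
  have hρ : (((n : ℝ) + 1) / (2 * n)) ^ (1 / p) = (((n : ℝ) + 1) / 2) ^ (1 / p) / N := by
    rw [← Real.div_rpow (by positivity) hn0.le, div_div]
  calc T / (N - n) ≤ T / (N / 2) := by
        gcongr
    _ ≤ (2 / p * (((n : ℝ) + 1) / 2) ^ (1 / p) * Q + ((n : ℝ) + 1) * N * Q') / (N / 2) := by
        gcongr
    _ = _ := by rw [hρ]; field_simp; ring

/-! ### Application to Cauchy samples -/

lemma norm_ofReal_add_le (α : ℂ) (x : ℝ) : ‖(x : ℂ) + α‖ ≤ (1 + ‖α‖) * (1 + |x|) := by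
  have := norm_add_le (x : ℂ) α
  rw [Complex.norm_real, Real.norm_eq_abs] at this
  nlinarith [mul_nonneg (norm_nonneg α) (abs_nonneg x)]

lemma ae_pi_cauchyMeasure_add_ne_zero (x₀ : ℝ) {σ : NNReal} (hσ : σ ≠ 0) (n : ℕ) (α : ℂ) :
    ∀ᵐ x : Fin n → ℝ ∂(Measure.pi fun _ => cauchyMeasure x₀ σ), ∀ j, (x j : ℂ) + α ≠ 0 := by
  refine ae_all_iff.2 fun j => ?_
  have h : ∀ᵐ x : ℝ ∂(cauchyMeasure x₀ σ), (x : ℂ) + α ≠ 0 := by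
    rw [cauchyMeasure_of_scale_ne_zero x₀ hσ]
    refine (withDensity_absolutelyContinuous _ _).ae_le ?_
    filter_upwards [Measure.ae_ne volume (-α).re] with x hx h0
    apply hx
    rw [← eq_neg_iff_add_eq_zero.2 h0, Complex.ofReal_re]
  exact (measurePreserving_eval (fun _ : Fin n => cauchyMeasure x₀ σ)
    j).quasiMeasurePreserving.ae h

/-- Independence reduces this to one moment of order 1/n, finite because n ≥ 2 makes the order less
than 1. -/
lemma integrable_prod_rpow_pi (x₀ : ℝ) {σ : NNReal} (hσ : σ ≠ 0) {n : ℕ} (hn : 2 ≤ n) (α : ℂ) :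
    Integrable (fun x : Fin n → ℝ => ∏ j, ‖(x j : ℂ) + α‖ ^ (1 / (n : ℝ)))
      (Measure.pi fun _ => cauchyMeasure x₀ σ) := by
  obtain ⟨K, -, hK⟩ := cauchyMeasure_moment x₀ hσ
  have hn1 : (1 : ℝ) < n := by exact_mod_cast hn
  have hlt : 1 / (n : ℝ) < 1 := by rw [div_lt_one (by linarith)]; exact hn1
  have h1 := (hK (1 - 1 / n) (by linarith)).1
  rw [sub_sub_cancel] at h1
  refine Integrable.fintype_prod (f := fun (_ : Fin n) (x : ℝ) => ‖(x : ℂ) + α‖ ^ (1 / (n : ℝ)))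
    fun _ => ?_
  refine (h1.const_mul ((1 + ‖α‖) ^ (1 / (n : ℝ)))).mono' ?_ (ae_of_all _ fun x => ?_)
  · exact Measurable.aestronglyMeasurable (by fun_prop)
  · rw [Real.norm_of_nonneg (by positivity), ← Real.mul_rpow (by positivity) (by positivity)]
    gcongr
    exact norm_ofReal_add_le α x

lemma measurable_geometricMean (α : ℂ) (n : ℕ) :
    Measurable (geometricMean α : (Fin n → ℝ) → ℂ) := by
  unfold geometricMean
  fun_prop

lemma integrable_geometricMean_pi (x₀ : ℝ) {σ : NNReal} (hσ : σ ≠ 0) {n : ℕ} (hn : 2 ≤ n) (α : ℂ) :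
    Integrable (geometricMean α : (Fin n → ℝ) → ℂ) (Measure.pi fun _ => cauchyMeasure x₀ σ) := by
  refine ((integrable_prod_rpow_pi x₀ hσ hn α).add (integrable_const ‖α‖)).mono'
    (measurable_geometricMean α n).aestronglyMeasurable (ae_of_all _ fun x => ?_)
  refine (norm_sub_le _ _).trans (add_le_add (le_of_eq ?_) le_rfl)
  rw [norm_prod]
  refine Finset.prod_congr rfl fun j _ => ?_
  rw [← Complex.norm_cpow_real]
  push_cast
  rfl

lemma integrable_powerDefect_shift_pi (x₀ : ℝ) {σ : NNReal} (hσ : σ ≠ 0) {n : ℕ} (hn : 2 ≤ n)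
    {α : ℂ} (hα : 0 ≤ α.im) {p : ℝ} (hp : 0 < p) (hp1 : p < 1) :
    Integrable (fun x : Fin n → ℝ => powerDefect p (fun j => (x j : ℂ) + α))
      (Measure.pi fun _ => cauchyMeasure x₀ σ) :=
  integrable_powerDefect_pi x₀ hσ hp hp1 hn (v := fun _ x => (x : ℂ) + α) (fun _ => by fun_prop)
    (by positivity) (fun _ x => norm_ofReal_add_le α x) fun _ x => by simpa using hα

lemma integrable_truncatedPowerSum_pi (x₀ : ℝ) {σ : NNReal} (hσ : σ ≠ 0) {n : ℕ} (hn : 2 ≤ n)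
    {α : ℂ} (hα : 0 ≤ α.im) {p : ℝ} (hp : 0 < p) (hp1 : p < 1) :
    Integrable (truncatedPowerSum α p : (Fin n → ℝ) → ℂ)
      (Measure.pi fun _ => cauchyMeasure x₀ σ) :=
  ((integrable_powerDefect_shift_pi x₀ hσ hn hα hp hp1).sub (integrable_const _)).congr
    (ae_of_all _ fun x => (truncatedPowerSum_eq hα hp hp1 (by omega) x).symm)

lemma integral_truncatedPowerMean_pi {γ : ℂ} (hγ : 0 < γ.im) {n : ℕ} (hn : 2 ≤ n)
    {α : ℂ} (hα : 0 ≤ α.im) {p : ℝ} (hp : 0 < p) (hp1 : p < 1) :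
    ∫ x : Fin n → ℝ, truncatedPowerMean α p x
      ∂(Measure.pi fun _ => cauchyMeasure γ.re ⟨γ.im, hγ.le⟩) = γ := by
  have hσ : (⟨γ.im, hγ.le⟩ : NNReal) ≠ 0 := fun h => hγ.ne' (congrArg NNReal.toReal h)
  have hne : ((((n : ℝ) ^ (1 / p) : ℝ) : ℂ) - n) ≠ 0 := by
    have h1 : (1 : ℝ) < n := by exact_mod_cast hn
    have h2 : 1 < 1 / p := by rw [lt_div_iff₀ hp]; linarith
    have hlt := Real.rpow_lt_rpow_of_exponent_lt h1 h2
    rw [Real.rpow_one] at hlt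
    rw [sub_ne_zero]; intro h
    exact hlt.ne' (by exact_mod_cast h)
  simp only [truncatedPowerMean_eq hα hp hp1 hn]
  have hdefect := integral_powerDefect_pi hγ hp hp1 hn hα
  set σ : NNReal := ⟨γ.im, hγ.le⟩
  rw [integral_sub ((integrable_powerDefect_shift_pi γ.re hσ hn hα hp hp1).div_const _)
    (integrable_const _), integral_div, hdefect,
    powerDefect_const hp hp1 (by omega) (by simpa using add_nonneg hγ.le hα),
    mul_div_cancel_left₀ _ hne]
  simp

lemma tendsto_eLpNorm_truncatedPowerMean_pi (x₀ : ℝ) {σ : NNReal} (hσ : σ ≠ 0) {n : ℕ} (hn : 2 ≤ n)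
    {α : ℂ} (hα : 0 ≤ α.im) :
    Tendsto (fun p : ℝ => eLpNorm (fun x : Fin n → ℝ => truncatedPowerMean α p x
      - geometricMean α x) 1 (Measure.pi fun _ => cauchyMeasure x₀ σ)) (𝓝[>] 0) (𝓝 0) := by
  obtain ⟨K, hK0, hK⟩ := integrable_crossMoment_pi x₀ hσ
  have hn2 : (2 : ℝ) ≤ n := by exact_mod_cast hn
  have hsmall : ∀ᶠ p : ℝ in 𝓝[>] 0, 0 < p ∧ p ≤ 1 / 2 := by
    filter_upwards [self_mem_nhdsWithin,
      nhdsWithin_le_nhds (eventually_le_nhds (show (0 : ℝ) < 1 / 2 by norm_num))] with p h1 h2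
    exact ⟨h1, h2⟩
  set ρ := ((n : ℝ) + 1) / (2 * n) with hρ
  have hρ0 : 0 < ρ := by positivity
  have hρ1 : ρ < 1 := by rw [hρ, div_lt_one (by positivity)]; linarith
  set D := 1 + ‖α‖ with hD
  have hD0 : 0 < D := by positivity
  have hcross := fun (p : ℝ) (h1 : 0 < p) (h2 : p < 1) =>
    hK n D (fun _ x => (x : ℂ) + α) p hD0 (fun _ => by fun_prop)
      (fun _ x => norm_ofReal_add_le α x) h1 h2
  have hQ0 : ∀ (q : ℝ) (x : Fin n → ℝ), 0 ≤ crossMoment q (fun j => ‖(x j : ℂ) + α‖) :=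
    fun q x => crossMoment_nonneg q fun _ => norm_nonneg _
  refine tendsto_eLpNorm_one_of_dominated_add
    (g := fun p x => 4 * (1 / p * ρ ^ (1 / p)) * crossMoment p (fun j => ‖(x j : ℂ) + α‖))
    (h := fun x => 2 * ((n : ℝ) + 1) * crossMoment (1 / 3) (fun j => ‖(x j : ℂ) + α‖)
      + ∏ j, ‖(x j : ℂ) + α‖ ^ (1 / (n : ℝ))) ?_ ?_ ?_ ?_ ?_ ?_ ?_ ?_
  · filter_upwards [hsmall] with p ⟨hp, hp1⟩
    have h1 := integrable_powerDefect_shift_pi x₀ hσ hn hα hp (by linarith)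
    simp only [truncatedPowerMean_eq hα hp (show p < 1 by linarith) hn]
    exact (((h1.div_const _).sub (integrable_const _)).sub
      (integrable_geometricMean_pi x₀ hσ hn α)).aestronglyMeasurable
  · filter_upwards [hsmall] with p ⟨hp, hp1⟩
    exact (hcross p hp (by linarith)).1.const_mul _
  · filter_upwards [hsmall] with p ⟨hp, hp1⟩
    exact ae_of_all _ fun x => mul_nonneg (by positivity) (hQ0 p x)
  · exact ((hcross (1 / 3) (by norm_num) (by norm_num)).1.const_mul _).add
      (integrable_prod_rpow_pi x₀ hσ hn α)
  · exact ae_of_all _ fun x => add_nonneg (mul_nonneg (by positivity) (hQ0 _ x))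
      (Finset.prod_nonneg fun _ _ => by positivity)
  · filter_upwards [hsmall] with p ⟨hp, hp1⟩
    exact ae_of_all _ fun x => norm_truncatedPowerMean_sub_le hα hp hp1 hn x
  -- One factor 1/p comes from the bound on the defect, the other from the moment of order 1 - p.
  -- The geometric decay of ρ^{1/p} beats both.
  · have hlim := (tendsto_sq_mul_rpow_one_div hρ0 hρ1).const_mul
      (8 * ((n : ℝ) ^ 2 * (D * (K * K))))
    rw [mul_zero] at hlim
    refine tendsto_of_tendsto_of_tendsto_of_le_of_le' tendsto_const_nhds hlim ?_ ?_
    · filter_upwards [hsmall] with p ⟨hp, hp1⟩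
      exact integral_nonneg fun x => mul_nonneg (by positivity) (hQ0 p x)
    · filter_upwards [hsmall] with p ⟨hp, hp1⟩
      rw [integral_const_mul]
      have hK2 : K / (1 - p) ≤ 2 * K := by
        rw [div_le_iff₀ (by linarith)]; nlinarith
      calc _ ≤ 4 * (1 / p * ρ ^ (1 / p)) * ((n : ℝ) ^ 2 * (D * (K / p * (2 * K)))) := by
            gcongr
            exact (hcross p hp (by linarith)).2.trans (by gcongr)
        _ = _ := by field_simp; ring
  · filter_upwards [ae_pi_cauchyMeasure_add_ne_zero x₀ hσ n α] with x hx
    have := (tendsto_truncatedPowerMean hα hn hx).sub_const (geometricMean α x)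
    rwa [sub_self] at this

theorem mainTheorem12 {Ω : Type*} [MeasurableSpace Ω] (P : Measure Ω) [IsProbabilityMeasure P]
    (γ : ℂ) (hγ : 0 < γ.im) (n : ℕ) (hn : 2 ≤ n) (X : Fin n → Ω → ℝ)
    (hindep : iIndepFun X P)
    (hlaw : ∀ j, HasLaw (X j) (cauchyMeasure γ.re ⟨γ.im, hγ.le⟩) P)
    (α : ℂ) (hα : 0 ≤ α.im) :
    -- integrability and unbiasedness
    (∀ p : ℝ, 0 < p → p < 1 →
      Integrable (fun ω => truncatedPowerSum α p (fun j => X j ω)) P ∧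
      Integrable (fun ω => truncatedPowerMean α p (fun j => X j ω)) P ∧
      ∫ ω, truncatedPowerMean α p (fun j => X j ω) ∂P = γ) ∧
    -- almost sure convergence as `p → 0+`
    (∀ᵐ ω ∂P, Tendsto (fun p : ℝ => truncatedPowerMean α p (fun j => X j ω)) (𝓝[>] 0)
      (𝓝 (geometricMean α (fun j => X j ω)))) ∧
    -- convergence in `L¹` as `p → 0+`
    (Integrable (fun ω => geometricMean α (fun j => X j ω)) P ∧
      Tendsto (fun p : ℝ => eLpNorm (fun ω => truncatedPowerMean α p (fun j => X j ω)
        - geometricMean α (fun j => X j ω)) 1 P) (𝓝[>] 0) (𝓝 0)) := by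
  have hσ : (⟨γ.im, hγ.le⟩ : NNReal) ≠ 0 := fun h => hγ.ne' (congrArg NNReal.toReal h)
  -- By independence the joint law is the product measure, so every assertion transfers from the
  -- coordinate space.
  have hX : HasLaw (fun ω j => X j ω)
      (Measure.pi fun _ : Fin n => cauchyMeasure γ.re ⟨γ.im, hγ.le⟩) P :=
    iIndepFun.hasLaw_pi hlaw hindep
  have hint : ∀ {F : (Fin n → ℝ) → ℂ},
      Integrable F (Measure.pi fun _ : Fin n => cauchyMeasure γ.re ⟨γ.im, hγ.le⟩) →
      Integrable (fun ω => F (fun j => X j ω)) P := by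
    intro F hF
    rw [← hX.map_eq] at hF
    exact hF.comp_aemeasurable hX.aemeasurable
  have hmean : ∀ {p : ℝ}, 0 < p → p < 1 → Integrable (truncatedPowerMean α p : (Fin n → ℝ) → ℂ)
      (Measure.pi fun _ : Fin n => cauchyMeasure γ.re ⟨γ.im, hγ.le⟩) := fun hp hp1 =>
    (integrable_truncatedPowerSum_pi γ.re hσ hn hα hp hp1).div_const _
  have hgeom := integrable_geometricMean_pi γ.re hσ hn α
  refine ⟨fun p hp hp1 => ⟨hint (integrable_truncatedPowerSum_pi γ.re hσ hn hα hp hp1),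
    hint (hmean hp hp1), ?_⟩, ?_, hint hgeom, ?_⟩
  · have := hX.integral_comp (hmean hp hp1).aestronglyMeasurable
    rw [integral_truncatedPowerMean_pi hγ hn hα hp hp1] at this
    exact this
  · have h := ae_pi_cauchyMeasure_add_ne_zero γ.re hσ n α
    rw [← hX.map_eq] at h
    filter_upwards [ae_of_ae_map hX.aemeasurable h] with ω hω
    exact tendsto_truncatedPowerMean hα hn hω
  · refine (tendsto_eLpNorm_truncatedPowerMean_pi γ.re hσ hn hα).congr' ?_
    filter_upwards [self_mem_nhdsWithin, nhdsWithin_le_nhds (eventually_lt_nhds one_pos)]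
      with p hp hp1
    have hm := ((hmean hp hp1).sub hgeom).aestronglyMeasurable
    have hmap := eLpNorm_map_measure (p := 1) (by rw [hX.map_eq]; exact hm) hX.aemeasurable
    rw [hX.map_eq] at hmap
    exact hmap
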